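/- **Model.** An agent has a private type $\theta\in\Theta=[\underline\theta,\bar\theta]$, $0\le\underline\theta<\bar\theta$, with a continuous density $f>0$ on $\Theta$. He chooses a quality $q\in Q=[0,q_{\max}]$ at cost $c(q)/\theta$, where $c$ is $C^2$ and strictly convex on $Q$, $c(0)=c'(0)=0$, $c'(q)>0$ for $q>0$, and $c(q_{\max})=\bar\theta q_{\max}$. The principal commits to a deterministic rating $\pi:Q\to S$. The agent then chooses $q$ and whether to take the test; the market observes the score $\pi(q)$, or a null signal if he does not take the test, and pays a wage $\omega$ equal to the expected quality given the signal (Bayes' rule on the path; off the path, the mean of some belief on the qualities consistent with the signal). The agent maximizes $\theta\omega-c(q)$. A quality scheme $q:\Theta\to Q$ is *induced* by $\pi$ if it is the quality choice in an equilibrium of this game. The principal maximizes expected quality $\mathbb E[q(\theta)]$, i.e. $v(q,\theta)=q$; a deterministic rating is *optimal* if it induces a quality scheme whose expected quality is at least that of any quality scheme induced by any deterministic rating. *Lower censorship* with minimum standard $q_0\in Q$ reveals $q$ if $q\ge q_0$ and gives "fail" otherwise; the *pass/fail test* with minimum standard $q_0\in Q$ gives "pass" if $q\ge q_0$ and "fail"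 otherwise; the *fully revealing test* is lower censorship with $q_0=0$. The *cutoff type* of the minimum standard $q_0$ is $\theta_0=c(q_0)/q_0$ ($\theta_0=0$ if $q_0=0$). For $\theta\in[0,\bar\theta]$ let $q_i(\theta)$ be the largest solution $q\in Q$ of $\theta q=c(q)$, and let $\theta_c(\theta)=c'(q_i(\theta))$. The density $f$ is *unimodal* if, for some $m\in\Theta$, it is (weakly) increasing on $[\underline\theta,m]$ and (weakly) decreasing on $[m,\bar\theta]$; a *mode* is a maximizer of $f$ on $\Theta$. Increasing and decreasing are meant weakly, on $\Theta$. **Proposition.** Let $v(q,\theta)=q$. 1. If $f$ is unimodal, then some lower censorship rating is optimal among deterministic ratings. 2. If $f$ is increasing, or if $f$ is unimodal and $\theta_c(\underline\theta)\ge\bar\theta$, then some pass/fail test is optimal. 3. If $f$ is decreasing, then there is an optimal lower censorship rating without exclusion: its cutoff type is at most $\underline\theta$, and it induces an optimal quality scheme in which every type $\theta>0$ chooses a positive quality. 4. The fully revealing test is optimal if and only if $f$ is decreasing and $\underline\theta=0$. 5. Let $f$ be unimodal. For every mode $\theta_m$ of $f$ there is an optimal lower censorship rating whose cutoff type $\theta_0^*$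 satisfies $\theta_0^*\in[\theta_c^{-1}(\theta_m),\theta_m]$. Conversely, if a lower censorship rating or a pass/fail test is optimal, then its cutoff type lies in $[\theta_c^{-1}(\theta_m),\theta_m]$ for some mode $\theta_m$ of $f$ (so for the mode, if it is unique). -/

import Mathlib

open MeasureTheory Set

/-- The primitives of the rating-design model, with multiplicatively separable cost `c(q)/θ`.
* Types lie in `Θ = [θlo, θhi] ⊆ [0, ∞)`, with a continuous positive density `f`.
* Qualities lie in `Q = [0, qmax]`, where `qmax` is the quality at which the highest type is
  indifferent to the outside option: `c qmax = θhi * qmax`.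
* The cost `c` is `C²` on `Q`, strictly convex, with `c(0) = c'(0) = 0` and `c' > 0` off `0`. -/
structure RatingModel where
  θlo : ℝ
  θhi : ℝ
  qmax : ℝ
  /-- density of the type distribution -/
  f : ℝ → ℝ
  /-- cost function -/
  c : ℝ → ℝ
  θlo_nonneg : 0 ≤ θlo
  θlo_lt_θhi : θlo < θhi
  f_cont : ContinuousOn f (Icc θlo θhi)
  f_pos : ∀ θ ∈ Icc θlo θhi, 0 < f θ
  f_integral : ∫ θ in θlo..θhi, f θ = 1
  qmax_pos : 0 < qmax
  c_contDiff : ContDiffOn ℝ 2 c (Icc 0 qmax)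
  c_zero : c 0 = 0
  c_deriv_zero : derivWithin c (Icc 0 qmax) 0 = 0
  c_deriv_pos : ∀ q ∈ Ioc 0 qmax, 0 < derivWithin c (Icc 0 qmax) q
  c_strictConvex : StrictConvexOn ℝ (Icc 0 qmax) c
  c_qmax : c qmax = θhi * qmax

namespace RatingModel

noncomputable section

variable (M : RatingModel)

/-- The type space `[θlo, θhi]`. -/
abbrev Typ : Type := Icc M.θlo M.θhi

/-- The set of qualities `[0, qmax]`. -/
def Q : Set ℝ := Icc 0 M.qmax

/-- The distribution of types. -/
def F : Measure M.Typ :=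
  ((volume : Measure ℝ).comap Subtype.val).withDensity (fun θ : M.Typ => ENNReal.ofReal (M.f θ))

/-- The marginal cost `c'` (one-sided at the endpoints of `Q`). -/
def marginalCost (q : ℝ) : ℝ := derivWithin M.c M.Q q

/-- The quality `q_i(θ)` that leaves type `θ` indifferent to the outside option: the largest
solution in `Q` of `θ q = c(q)` (for `θ > 0` the only other one is `0`; `q_i(0) = 0`). -/
def qi (θ : ℝ) : ℝ := sSup {q ∈ M.Q | θ * q = M.c q}

/-- `θ_c(θ) = c'(q_i(θ))`, the type that would choose `q_i(θ)` under full revelation. -/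
def thetaC (θ : ℝ) : ℝ := M.marginalCost (M.qi θ)

/-- The inverse of `θ_c`, as a function on `[0, θhi]`. -/
def thetaCInv : ℝ → ℝ := Function.invFunOn M.thetaC (Icc 0 M.θhi)

/-- The cutoff type `θ₀ = c(q₀)/q₀` of a minimum standard `q₀`. For `q₀ = 0` it is `0`, which is
the limit of `c(q)/q` at `0`. -/
def cutoff (q₀ : ℝ) : ℝ := M.c q₀ / q₀

/-- The signal that the market observes: the score `π q` if an agent of quality `q` takes the
test, and the null signal `none` if he does not. -/
def signal {S : Type*} (π : ℝ → S) (q : ℝ) (takes : Bool) : Option S :=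
  if takes = true then some (π q) else none

/-- The σ-algebra on types generated by a signal map, the set of signals carrying the finest
σ-algebra for which this map is measurable. -/
abbrev signalSigma {α : Type*} (sig : M.Typ → α) : MeasurableSpace M.Typ :=
  (MeasurableSpace.map sig inferInstance).comap sig

/-- Equilibrium of the game induced by the deterministic rating `π : Q → S` (only the values of
`π` on `Q` matter): types `θ` choose the quality `q θ` and take the test iff `takes θ`, and the
market pays the wage `ω s` after the signal `s`. The payoff of type `θ` is `θ ω(s) - c(q)`, which
is `θ` times `ω(s) - c(q)/θ`. -/
structure IsEquilibrium {S : Type*} (π : ℝ → S) (q : M.Typ → ℝ) (takes : M.Typ → Bool)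
    (ω : Option S → ℝ) : Prop where
  measurable : Measurable q
  mem : ∀ θ, q θ ∈ M.Q
  /-- on the path, the wage is the conditional expectation of quality given the signal -/
  bayes : (fun θ => ω (signal π (q θ) (takes θ)))
    =ᵐ[M.F] M.F[q | M.signalSigma (fun θ => signal π (q θ) (takes θ))]
  /-- at any score, the wage is the mean of a belief on the qualities that obtain this score -/
  wage_score : ∀ x ∈ M.Q, ω (some (π x)) ∈ convexHull ℝ {y ∈ M.Q | π y = π x}
  wage_null : ω none ∈ M.Q
  /-- every type chooses quality and participation optimally -/
  optimal : ∀ θ : M.Typ, ∀ x ∈ M.Q, ∀ t : Bool,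
    (θ : ℝ) * ω (signal π x t) - M.c x ≤ (θ : ℝ) * ω (signal π (q θ) (takes θ)) - M.c (q θ)

/-- The rating `π` induces (implements) the quality scheme `q`. -/
def Induces {S : Type*} (π : ℝ → S) (q : M.Typ → ℝ) : Prop :=
  ∃ takes ω, M.IsEquilibrium π q takes ω

/-- The principal's expected payoff from a quality scheme, for the utility function `v(q, θ)`. -/
def payoff (v : ℝ → ℝ → ℝ) (q : M.Typ → ℝ) : ℝ := ∫ θ, v (q θ) θ ∂M.F

/-- The deterministic rating `π`, inducing the scheme `q`, is optimal for the principal among all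
deterministic ratings and all quality schemes which these induce. -/
def IsOptimal (v : ℝ → ℝ → ℝ) {S : Type*} (π : ℝ → S) (q : M.Typ → ℝ) : Prop :=
  M.Induces π q ∧
    ∀ (S' : Type) (π' : ℝ → S') (q' : M.Typ → ℝ), M.Induces π' q' → M.payoff v q' ≤ M.payoff v q

/-- Lower censorship with minimum standard `q₀`; the score `none` is "fail". -/
def lowerCensorship (q₀ : ℝ) (x : ℝ) : Option ℝ :=
  if q₀ ≤ x then some x else none

/-- The pass/fail test with minimum standard `q₀`; `true` is "pass". -/
def passFail (q₀ : ℝ) (x : ℝ) : Bool :=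
  if q₀ ≤ x then true else false

/-- The fully revealing test. -/
def fullyRevealing : ℝ → Option ℝ := lowerCensorship 0

/-- No exclusion: every type (except possibly type `0`, for whom any effort is
prohibitively costly) chooses a positive quality. -/
def NoExclusion (q : M.Typ → ℝ) : Prop := ∀ θ : M.Typ, 0 < (θ : ℝ) → 0 < q θ

/-- The density is (weakly) unimodal. -/
def Unimodal : Prop :=
  ∃ m ∈ Icc M.θlo M.θhi, MonotoneOn M.f (Icc M.θlo m) ∧ AntitoneOn M.f (Icc m M.θhi)

/-- `m` is a mode of the density. -/
def IsMode (m : ℝ) : Prop := m ∈ Icc M.θlo M.θhi ∧ ∀ θ ∈ Icc M.θlo M.θhi, M.f θ ≤ M.f m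

/-- The principal's utility under quality maximization, `v(q, θ) = q`. -/
def quality : ℝ → ℝ → ℝ := fun q _ => q

end

end RatingModel

/-!
A deterministic rating amounts to a menu of qualities, from which a type `θ` picks `q` to maximize
`θ q - c q`: on the equilibrium path the wage is the quality. The choices from a menu form a
subgradient of its indirect utility `u`. If `f` is unimodal, then its superlevel sets are intervals
`[l, r]` around the mode, and by the layer-cake formula the expected quality is the integral of
`u r - u l` over the levels. Every menu is therefore dominated by a lower censorship menu whose
indirect utility is at most `u` below the mode and at least `u` above it. Pass/fail does as well as
lower censorship when no type would choose a quality above the standard. Conversely, withdrawing an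
interval of qualities from the full menu changes the expected quality by the integral of a primitive
of `f - l`, for any constant `l`, and this can be made positive wherever `f` increases.
-/

/-! ### Subgradients of functions of a real variable -/

/-- `g a` is a subgradient of the (necessarily convex) function `u` at every point `a`. Indirect
utilities and the choices that generate them are related in this way. -/
def IsSubgradient (u g : ℝ → ℝ) : Prop := ∀ a b, u a + g a * (b - a) ≤ u b

namespace IsSubgradient

variable {u g : ℝ → ℝ}

lemma monotone (h : IsSubgradient u g) : Monotone g := by
  intro a b hab
  rcases hab.eq_or_lt with rfl | hlt
  · rfl
  · by_contra! hc
    nlinarith [h a b, h b a, mul_pos (sub_pos.2 hlt) (sub_pos.2 hc)]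

lemma convexOn (h : IsSubgradient u g) : ConvexOn ℝ univ u := by
  refine ⟨convex_univ, fun x _ y _ s t hs ht hst => ?_⟩
  have hx := mul_le_mul_of_nonneg_left (h (s * x + t * y) x) hs
  have hy := mul_le_mul_of_nonneg_left (h (s * x + t * y) y) ht
  obtain rfl : t = 1 - s := by linarith
  simp only [smul_eq_mul]
  linarith

lemma continuous (h : IsSubgradient u g) : Continuous u :=
  continuousOn_univ.1 (h.convexOn.continuousOn isOpen_univ)

lemma hasDerivAt (h : IsSubgradient u g) {x : ℝ} (hg : ContinuousAt g x) :
    HasDerivAt u (g x) x := by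
  rw [hasDerivAt_iff_isLittleO, Asymptotics.isLittleO_iff]
  intro ε hε
  filter_upwards [Metric.continuousAt_iff'.1 hg ε hε] with s hs
  rw [Real.dist_eq] at hs
  rw [smul_eq_mul, Real.norm_eq_abs, Real.norm_eq_abs, abs_of_nonneg (by linarith [h x s])]
  calc u s - u x - (s - x) * g x ≤ (g s - g x) * (s - x) := by linarith [h s x]
    _ ≤ |g s - g x| * |s - x| := by rw [← abs_mul]; exact le_abs_self _
    _ ≤ ε * |s - x| := mul_le_mul_of_nonneg_right hs.le (abs_nonneg _)

lemma integral_eq_sub (h : IsSubgradient u g) (a b : ℝ) : ∫ x in a..b, g x = u b - u a :=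
  MeasureTheory.integral_eq_of_hasDerivAt_off_countable _ _ h.monotone.countable_not_continuousAt
    h.continuous.continuousOn (fun _ hx => h.hasDerivAt (not_not.1 hx.2))
    h.monotone.intervalIntegrable

end IsSubgradient

/-! ### Integration against a quasiconcave density -/

lemma integral_mul_eq_integral_setIntegral_superlevel {α : Type*} [MeasurableSpace α]
    {μ : Measure α} [SFinite μ] {f w : α → ℝ} {K : ℝ} (hf : AEStronglyMeasurable f μ)
    (hf0 : 0 ≤ᵐ[μ] f) (hfK : f ≤ᵐ[μ] fun _ => K) (hw : Integrable w μ) (hw0 : 0 ≤ᵐ[μ] w) :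
    ∫ x, f x * w x ∂μ = ∫ t in Ioc 0 K, ∫ x in {x | t ≤ f x}, w x ∂μ := by
  set ν := μ.withDensity fun x => ENNReal.ofReal (w x)
  have hac : ν ≪ μ := withDensity_absolutelyContinuous _ _
  have hνfin : IsFiniteMeasure ν := isFiniteMeasure_withDensity_ofReal hw.2
  have hfν : Integrable f ν := by
    refine Integrable.of_bound (hf.mono_ac hac) K ?_
    filter_upwards [hac.ae_le hf0, hac.ae_le hfK] with x h0 hK
    rwa [Real.norm_of_nonneg h0]
  have hν : ∀ s, ν.real s = ∫ x in s, w x ∂μ := fun s => by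
    rw [Measure.real, withDensity_apply', integral_eq_lintegral_of_nonneg_ae
      (ae_restrict_of_ae hw0) hw.1.restrict]
  calc ∫ x, f x * w x ∂μ = ∫ x, (ENNReal.ofReal (w x)).toReal • f x ∂μ := by
        refine integral_congr_ae ?_
        filter_upwards [hw0] with x hx
        rw [ENNReal.toReal_ofReal hx, smul_eq_mul, mul_comm]
    _ = ∫ x, f x ∂ν := (integral_withDensity_eq_integral_toReal_smul₀
        hw.1.aemeasurable.ennreal_ofReal (.of_forall fun _ => ENNReal.ofReal_lt_top) f).symm
    _ = ∫ t in Ioc 0 K, ν.real {x | t ≤ f x} :=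
        hfν.integral_eq_integral_Ioc_meas_le (hac.ae_le hf0) (hac.ae_le hfK)
    _ = ∫ t in Ioc 0 K, ∫ x in {x | t ≤ f x}, w x ∂μ := by simp only [hν]

section QuasiconcaveDensity

variable {f : ℝ → ℝ} {a b m : ℝ}

/-- On `[a, b]`, where `f` has its peak at `m`, the superlevel set of `f` at each level `t ≤ f m` is
the interval `[l t, r t]`. -/
def IsSuperlevelBounds (f : ℝ → ℝ) (a b m : ℝ) (l r : ℝ → ℝ) : Prop :=
  ∀ t ≤ f m, l t ∈ Icc a m ∧ r t ∈ Icc m b ∧ {x ∈ Icc a b | t ≤ f x} = Icc (l t) (r t)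

lemma exists_isSuperlevelBounds (hf : ContinuousOn f (Icc a b))
    (hq : QuasiconcaveOn ℝ (Icc a b) f) (hm : m ∈ Icc a b) :
    ∃ l r, IsSuperlevelBounds f a b m l r := by
  refine ⟨fun t => sInf {x ∈ Icc a b | t ≤ f x}, fun t => sSup {x ∈ Icc a b | t ≤ f x},
    fun t ht => ?_⟩
  have hmem : m ∈ {x ∈ Icc a b | t ≤ f x} := ⟨hm, ht⟩
  have hcompact : IsCompact {x ∈ Icc a b | t ≤ f x} :=
    isCompact_Icc.of_isClosed_subset (hf.preimage_isClosed_of_isClosed isClosed_Icc isClosed_Ici)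
      fun _ hx => hx.1
  refine ⟨⟨le_csInf ⟨m, hmem⟩ fun _ hx => hx.1.1, csInf_le hcompact.bddBelow hmem⟩,
    ⟨le_csSup hcompact.bddAbove hmem, csSup_le ⟨m, hmem⟩ fun _ hx => hx.1.2⟩,
    eq_Icc_of_connected_compact ⟨⟨m, hmem⟩, (hq t).isPreconnected⟩ hcompact⟩

namespace IsSuperlevelBounds

variable {l r u g : ℝ → ℝ}

lemma mem_uIoo (h : IsSuperlevelBounds f a b m l r) (hf : ContinuousOn f (Icc a b))
    (hm : m ∈ Icc a b) {c t : ℝ} (hc : c ∈ Icc a b) (ht : t ∈ Ioo (f c) (f m)) :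
    l t ∈ uIoo m c ∨ r t ∈ uIoo m c := by
  obtain ⟨hl, hr, hlr⟩ := h t ht.2.le
  have hcl : c ∉ Icc (l t) (r t) := hlr ▸ fun h => h.2.not_gt ht.1
  obtain ⟨s, hts, hsm⟩ := exists_between ht.2
  obtain ⟨x, hx, rfl⟩ := intermediate_value_uIcc (hf.mono (uIcc_subset_Icc hc hm))
    (Icc_subset_uIcc ⟨(ht.1.trans hts).le, hsm.le⟩)
  have hxl : x ∈ Icc (l t) (r t) := hlr ▸ ⟨uIcc_subset_Icc hc hm hx, hts.le⟩
  have hxm : x ≠ m := by rintro rfl; exact hsm.false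
  rcases le_total c m with hcm | hmc
  · rw [uIcc_of_le hcm] at hx
    rw [uIoo_of_ge hcm]
    refine .inl ⟨?_, hxl.1.trans_lt (hx.2.lt_of_ne hxm)⟩
    exact not_le.1 fun hlc => hcl ⟨hlc, hcm.trans hr.1⟩
  · rw [uIcc_of_ge hmc] at hx
    rw [uIoo_of_le hmc]
    refine .inr ⟨(hx.1.lt_of_ne' hxm).trans_le hxl.2, ?_⟩
    exact not_le.1 fun hcr => hcl ⟨hl.2.trans hmc, hcr⟩

/-- The layer-cake formula, in which the inner integrals are increments of `u`. -/
lemma integral_mul_eq (h : IsSuperlevelBounds f a b m l r) (hf : ContinuousOn f (Icc a b))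
    (hf0 : ∀ x ∈ Icc a b, 0 ≤ f x) (hfm : ∀ x ∈ Icc a b, f x ≤ f m) (hm : m ∈ Icc a b)
    (hu : IsSubgradient u g) (hg : ∀ x ∈ Icc a b, 0 ≤ g x) :
    ∫ x in a..b, f x * g x = ∫ t in 0..f m, (u (r t) - u (l t)) := by
  rw [intervalIntegral.integral_of_le (hm.1.trans hm.2), ← integral_Icc_eq_integral_Ioc,
    intervalIntegral.integral_of_le (hf0 m hm)]
  have hae {p : ℝ → Prop} (hp : ∀ x ∈ Icc a b, p x) : ∀ᵐ x ∂volume.restrict (Icc a b), p x :=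
    (ae_restrict_mem measurableSet_Icc).mono hp
  rw [integral_mul_eq_integral_setIntegral_superlevel
    (hf.aestronglyMeasurable measurableSet_Icc) (hae hf0) (hae hfm)
    (hu.monotone.locallyIntegrable.integrableOn_isCompact isCompact_Icc) (hae hg)]
  refine setIntegral_congr_fun measurableSet_Ioc fun t ht => ?_
  obtain ⟨hl, hr, hlr⟩ := h t ht.2
  rw [Measure.restrict_restrict' measurableSet_Icc, inter_comm]
  change ∫ x in {x ∈ Icc a b | t ≤ f x}, g x = _
  rw [hlr, integral_Icc_eq_integral_Ioc, ← intervalIntegral.integral_of_le (hl.2.trans hr.1),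
    hu.integral_eq_sub]

lemma intervalIntegrable (h : IsSuperlevelBounds f a b m l r) (hfm : 0 ≤ f m)
    (hu : IsSubgradient u g) (hg : ∀ x ∈ Icc a b, 0 ≤ g x) :
    IntervalIntegrable (fun t => u (r t) - u (l t)) volume 0 (f m) := by
  refine AntitoneOn.intervalIntegrable fun s hs t ht hst => ?_
  rw [uIcc_of_le hfm] at hs ht
  obtain ⟨hls, hrs, hlrs⟩ := h s hs.2
  obtain ⟨hlt, hrt, hlrt⟩ := h t ht.2
  have hsub : Icc (l t) (r t) ⊆ Icc (l s) (r s) := by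
    rw [← hlrs, ← hlrt]
    exact fun x hx => ⟨hx.1, hst.trans hx.2⟩
  obtain ⟨hl, hr⟩ := (Icc_subset_Icc_iff (hlt.2.trans hrt.1)).1 hsub
  change _ - _ ≤ _ - _
  rw [← hu.integral_eq_sub, ← hu.integral_eq_sub]
  refine intervalIntegral.integral_mono_interval hl (hlt.2.trans hrt.1) hr ?_
    hu.monotone.intervalIntegrable
  filter_upwards [ae_restrict_mem measurableSet_Ioc] with x hx
  exact hg x ⟨hls.1.trans hx.1.le, hx.2.trans hrs.2⟩

end IsSuperlevelBounds

end QuasiconcaveDensity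

/-! ### Minima of primitives -/

lemma hasDerivWithinAt_integral_Icc {k : ℝ → ℝ} {a b c t : ℝ} (hk : ContinuousOn k (Icc a b))
    (hc : c ∈ Icc a b) (ht : t ∈ Icc a b) :
    HasDerivWithinAt (fun s => ∫ x in c..s, k x) (k t) (Icc a b) t := by
  have : Fact (t ∈ Icc a b) := ⟨ht⟩
  exact intervalIntegral.integral_hasDerivWithinAt_right
    (hk.mono (uIcc_subset_Icc hc ht)).intervalIntegrable
    (hk.stronglyMeasurableAtFilter_nhdsWithin measurableSet_Icc t) (hk t ht)

lemma sub_mul_nonneg_of_isMinOn_integral {k : ℝ → ℝ} {a b t s : ℝ} (hk : ContinuousOn k (Icc a b))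
    (ht : t ∈ Icc a b) (hmin : IsMinOn (fun s => ∫ x in t..s, k x) (Icc a b) t)
    (hs : s ∈ Icc a b) : 0 ≤ (s - t) * k t := by
  simpa using hmin.localize.hasFDerivWithinAt_nonneg
    (hasDerivWithinAt_integral_Icc hk ht ht).hasFDerivWithinAt
    (sub_mem_posTangentConeAt_of_segment_subset ((convex_Icc a b).segment_subset ht hs))

lemma exists_forall_integral_sub_nonneg {f : ℝ → ℝ} {a b : ℝ} (hf : ContinuousOn f (Icc a b))
    (hab : a < b) (hfab : f a < f b) :
    ∃ l, ∃ t ∈ Ioo a b, (∀ s ∈ Icc a b, 0 ≤ ∫ x in t..s, (f x - l)) ∧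
      0 < ∫ x in t..a, (f x - l) ∧ 0 < ∫ x in t..b, (f x - l) := by
  obtain ⟨l, hal, hlb⟩ := exists_between hfab
  have hk : ContinuousOn (fun x => f x - l) (Icc a b) := hf.sub continuousOn_const
  have hki {x y : ℝ} (hx : x ∈ Icc a b) (hy : y ∈ Icc a b) :
      IntervalIntegrable (fun θ => f θ - l) volume x y :=
    (hk.mono (uIcc_subset_Icc hx hy)).intervalIntegrable
  have ha : a ∈ Icc a b := left_mem_Icc.2 hab.le
  have hb : b ∈ Icc a b := right_mem_Icc.2 hab.le
  obtain ⟨t, ht, hmin⟩ := isCompact_Icc.exists_isMinOn ⟨a, ha⟩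
    (intervalIntegral.continuousOn_primitive_interval' (hki ha hb) left_mem_uIcc |>.mono
      Icc_subset_uIcc)
  have hnonneg {s : ℝ} (hs : s ∈ Icc a b) : 0 ≤ ∫ x in t..s, (f x - l) := by
    rw [← intervalIntegral.integral_interval_sub_left (hki ha hs) (hki ha ht)]
    exact sub_nonneg.2 (hmin hs)
  have hpos {e e' : ℝ} (he : e ∈ Icc a b) (he' : e' ∈ Icc a b)
      (hlt : (e' - e) * (f e - l) < 0) : 0 < ∫ x in t..e, (f x - l) := by
    refine (hnonneg he).lt_of_ne' fun h0 => hlt.not_ge ?_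
    refine sub_mul_nonneg_of_isMinOn_integral hk he (fun s hs => ?_) he'
    change ∫ x in e..e, (f x - l) ≤ ∫ x in e..s, (f x - l)
    rw [intervalIntegral.integral_same,
      ← intervalIntegral.integral_interval_sub_left (hki ht hs) (hki ht he), h0, sub_zero]
    exact hnonneg hs
  have hta := hpos ha hb (mul_neg_of_pos_of_neg (sub_pos.2 hab) (sub_neg.2 hal))
  have htb := hpos hb ha (mul_neg_of_neg_of_pos (sub_neg.2 hab) (sub_pos.2 hlb))
  refine ⟨l, t, ⟨ht.1.lt_of_ne' ?_, ht.2.lt_of_ne ?_⟩, fun s => hnonneg, hta, htb⟩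
  · rintro rfl
    simp at hta
  · rintro rfl
    simp at htb

/-! ### Integration against the inverse of a monotone function -/

/-- This is integration by parts for `∫ g dK`, where `g` is the inverse of `φ`, after the
substitution `x = φ y`. -/
lemma integral_mul_leftInvOn_eq_sub {φ φ' g k K : ℝ → ℝ} {a b : ℝ} (hab : a ≤ b)
    (hφ : ∀ y ∈ Icc a b, HasDerivWithinAt φ (φ' y) (Icc a b) y)
    (hφ' : ContinuousOn φ' (Icc a b)) (hmono : MonotoneOn φ (Icc a b))
    (hg : LeftInvOn g φ (Icc a b)) (hk : ContinuousOn k (Icc (φ a) (φ b)))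
    (hK : ∀ x ∈ Icc (φ a) (φ b), HasDerivWithinAt K (k x) (Icc (φ a) (φ b)) x) :
    ∫ x in φ a..φ b, k x * g x = b * K (φ b) - a * K (φ a) - ∫ y in a..b, K (φ y) := by
  have hcont : ContinuousOn φ (Icc a b) := fun y hy => (hφ y hy).continuousWithinAt
  have hmaps : MapsTo φ (Icc a b) (Icc (φ a) (φ b)) := hmono.mapsTo_Icc
  have hsubst : ∫ x in φ a..φ b, k x * g x = ∫ y in a..b, y * (k (φ y) * φ' y) := by
    rw [intervalIntegral.integral_of_le (hmono (left_mem_Icc.2 hab) (right_mem_Icc.2 hab) hab),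
      intervalIntegral.integral_of_le hab, ← integral_Icc_eq_integral_Ioc,
      ← integral_Icc_eq_integral_Ioc, ← hcont.image_Icc_of_monotoneOn hab hmono,
      integral_image_eq_integral_deriv_smul_of_monotoneOn measurableSet_Icc hφ hmono]
    refine setIntegral_congr_fun measurableSet_Icc fun y hy => ?_
    simp only [hg hy, smul_eq_mul]
    ring
  have hparts := intervalIntegral.integral_mul_deriv_eq_deriv_mul_of_hasDerivWithinAt
    (a := a) (b := b) (u := id) (u' := fun _ => 1) (v := K ∘ φ) (v' := fun y => k (φ y) * φ' y)
    (fun y _ => hasDerivWithinAt_id y _)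
    (by rw [uIcc_of_le hab]; exact fun y hy => (hK _ (hmaps hy)).comp y (hφ y hy) hmaps)
    intervalIntegrable_const
    (ContinuousOn.intervalIntegrable_of_Icc hab ((hk.comp hcont hmaps).mul hφ'))
  simpa [hsubst] using hparts

namespace RatingModel

noncomputable section

variable (M : RatingModel)

/-! ### Costs and surplus -/

lemma zero_mem_Q : (0 : ℝ) ∈ M.Q := ⟨le_rfl, M.qmax_pos.le⟩

lemma qmax_mem_Q : M.qmax ∈ M.Q := ⟨M.qmax_pos.le, le_rfl⟩

lemma isCompact_Q : IsCompact M.Q := isCompact_Icc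

lemma c_continuousOn : ContinuousOn M.c M.Q := M.c_contDiff.continuousOn

lemma c_differentiableOn : DifferentiableOn ℝ M.c M.Q :=
  M.c_contDiff.differentiableOn (by norm_num)

lemma marginalCost_contDiffOn : ContDiffOn ℝ 1 M.marginalCost M.Q :=
  M.c_contDiff.derivWithin (uniqueDiffOn_Icc M.qmax_pos) (by norm_num)

lemma marginalCost_continuousOn : ContinuousOn M.marginalCost M.Q :=
  M.marginalCost_contDiffOn.continuousOn

lemma marginalCost_strictMonoOn : StrictMonoOn M.marginalCost M.Q :=
  M.c_strictConvex.strictMonoOn_derivWithin M.c_differentiableOn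

lemma marginalCost_zero : M.marginalCost 0 = 0 := M.c_deriv_zero

lemma marginalCost_nonneg {x : ℝ} (hx : x ∈ M.Q) : 0 ≤ M.marginalCost x :=
  M.marginalCost_zero ▸ M.marginalCost_strictMonoOn.monotoneOn M.zero_mem_Q hx hx.1

/-- The payoff of type `θ` from the quality `q` if the wage is equal to the quality. -/
def surplus (θ q : ℝ) : ℝ := θ * q - M.c q

lemma surplus_zero_right (θ : ℝ) : M.surplus θ 0 = 0 := by simp [surplus, M.c_zero]

lemma surplus_continuousOn (θ : ℝ) : ContinuousOn (M.surplus θ) M.Q :=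
  (continuousOn_const.mul continuousOn_id).sub M.c_continuousOn

lemma surplus_lt_tangent {x y : ℝ} (hx : x ∈ M.Q) (hy : y ∈ M.Q) (hxy : x ≠ y) (θ : ℝ) :
    M.surplus θ y < M.surplus θ x + (θ - M.marginalCost x) * (y - x) := by
  have hc : M.c x + M.marginalCost x * (y - x) < M.c y := by
    rcases lt_or_gt_of_ne hxy with h | h
    · have := M.c_strictConvex.derivWithin_lt_slope hx hy h (M.c_differentiableOn x hx)
      rw [slope_def_field, lt_div_iff₀ (sub_pos.2 h)] at this
      exact lt_sub_iff_add_lt'.1 this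
    · have := M.c_strictConvex.slope_lt_derivWithin hy hx h (M.c_differentiableOn x hx)
      rw [slope_def_field, div_lt_iff₀ (sub_pos.2 h)] at this
      have h' : M.c x - M.c y < M.marginalCost x * (x - y) := this
      linarith
  unfold surplus
  linarith

variable {M} {θ x y : ℝ}

lemma surplus_lt_of_le_marginalCost (hx : x ∈ M.Q) (hy : y ∈ M.Q) (hθ : θ ≤ M.marginalCost x)
    (hxy : x < y) : M.surplus θ y < M.surplus θ x :=
  (M.surplus_lt_tangent hx hy hxy.ne θ).trans_le <| add_le_of_nonpos_right <|
    mul_nonpos_of_nonpos_of_nonneg (sub_nonpos.2 hθ) (sub_nonneg.2 hxy.le)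

lemma surplus_lt_of_marginalCost_le (hx : x ∈ M.Q) (hy : y ∈ M.Q) (hθ : M.marginalCost x ≤ θ)
    (hyx : y < x) : M.surplus θ y < M.surplus θ x :=
  (M.surplus_lt_tangent hx hy hyx.ne' θ).trans_le <| add_le_of_nonpos_right <|
    mul_nonpos_of_nonneg_of_nonpos (sub_nonneg.2 hθ) (sub_nonpos.2 hyx.le)

lemma surplus_marginalCost_lt (hx : x ∈ M.Q) (hy : y ∈ M.Q) (hxy : x ≠ y) :
    M.surplus (M.marginalCost x) y < M.surplus (M.marginalCost x) x :=
  hxy.lt_or_gt.elim (surplus_lt_of_le_marginalCost hx hy le_rfl)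
    (surplus_lt_of_marginalCost_le hx hy le_rfl)

lemma surplus_marginalCost_le (hx : x ∈ M.Q) (hy : y ∈ M.Q) :
    M.surplus (M.marginalCost x) y ≤ M.surplus (M.marginalCost x) x := by
  rcases eq_or_ne x y with rfl | hxy
  · rfl
  · exact (surplus_marginalCost_lt hx hy hxy).le

variable (M)

lemma c_strictMonoOn : StrictMonoOn M.c M.Q := fun x hx y hy hxy => by
  have := surplus_lt_of_le_marginalCost hx hy (M.marginalCost_nonneg hx) hxy
  simp only [surplus, zero_mul, zero_sub] at this
  exact neg_lt_neg_iff.1 this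

lemma θhi_lt_marginalCost_qmax : M.θhi < M.marginalCost M.qmax := by
  by_contra! h
  have := surplus_lt_of_marginalCost_le M.qmax_mem_Q M.zero_mem_Q h M.qmax_pos
  simp [surplus, M.c_qmax, M.c_zero] at this

lemma exists_marginalCost_eq (hθ : θ ∈ Icc 0 M.θhi) : ∃ x ∈ M.Q, M.marginalCost x = θ :=
  intermediate_value_Icc M.qmax_pos.le M.marginalCost_continuousOn
    ⟨M.marginalCost_zero.le.trans hθ.1, hθ.2.trans M.θhi_lt_marginalCost_qmax.le⟩

variable {M}

lemma exists_surplus_eq (hθ : θ ≤ M.θhi) (hx : x ∈ M.Q) {u : ℝ}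
    (hu : u ∈ Icc 0 (M.surplus θ x)) : ∃ y ∈ M.Q, x ≤ y ∧ M.surplus θ y = u := by
  have hmax : M.surplus θ M.qmax ≤ u := by
    rw [surplus, M.c_qmax, ← sub_mul]
    exact (mul_nonpos_of_nonpos_of_nonneg (sub_nonpos.2 hθ) M.qmax_pos.le).trans hu.1
  obtain ⟨y, hy, h⟩ := intermediate_value_Icc' hx.2
    ((M.surplus_continuousOn θ).mono (Icc_subset_Icc_left hx.1)) ⟨hmax, hu.2⟩
  exact ⟨y, ⟨hx.1.trans hy.1, hy.2⟩, hy.1, h⟩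

/-! ### Cutoff types -/

variable (M) in
lemma cutoff_zero : M.cutoff 0 = 0 := div_zero _

lemma cutoff_le_iff (hx : x ∈ M.Q) (hθ : 0 ≤ θ) : M.cutoff x ≤ θ ↔ 0 ≤ M.surplus θ x := by
  rcases hx.1.eq_or_lt with rfl | hx0
  · simp [cutoff_zero, hθ, surplus_zero_right]
  · rw [cutoff, div_le_iff₀ hx0, surplus, sub_nonneg]

variable (M) in
lemma surplus_cutoff (x : ℝ) : M.surplus (M.cutoff x) x = 0 := by
  rcases eq_or_ne x 0 with rfl | hx
  · exact M.surplus_zero_right _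
  · rw [surplus, cutoff, div_mul_cancel₀ _ hx, sub_self]

lemma cutoff_nonneg (hx : x ∈ M.Q) : 0 ≤ M.cutoff x :=
  div_nonneg (M.c_zero ▸ M.c_strictMonoOn.monotoneOn M.zero_mem_Q hx hx.1) hx.1

lemma cutoff_le_marginalCost (hx : x ∈ M.Q) : M.cutoff x ≤ M.marginalCost x := by
  rw [cutoff_le_iff hx (M.marginalCost_nonneg hx), ← M.surplus_zero_right]
  exact surplus_marginalCost_le hx M.zero_mem_Q

lemma cutoff_lt_marginalCost (hx : x ∈ M.Q) (hx0 : 0 < x) : M.cutoff x < M.marginalCost x := by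
  refine (cutoff_le_marginalCost hx).lt_of_ne fun h => ?_
  have := surplus_marginalCost_lt hx M.zero_mem_Q hx0.ne'
  rw [surplus_zero_right, ← h, surplus_cutoff] at this
  exact this.false

variable (M) in
lemma cutoff_strictMonoOn : StrictMonoOn M.cutoff M.Q := by
  intro x hx y hy hxy
  by_contra! h
  have hy' := (cutoff_le_iff hy (cutoff_nonneg hx)).1 h
  refine hy'.not_gt ((surplus_lt_of_le_marginalCost hx hy (cutoff_le_marginalCost hx) hxy).trans_eq
    (M.surplus_cutoff x))

lemma cutoff_mem (hx : x ∈ M.Q) : M.cutoff x ∈ Icc 0 M.θhi := by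
  refine ⟨cutoff_nonneg hx, ?_⟩
  calc M.cutoff x ≤ M.cutoff M.qmax := M.cutoff_strictMonoOn.monotoneOn hx M.qmax_mem_Q hx.2
    _ = M.θhi := by rw [cutoff, M.c_qmax, mul_div_cancel_right₀ _ M.qmax_pos.ne']

variable (M) in
lemma exists_cutoff_eq (hθ : θ ∈ Icc 0 M.θhi) : ∃ x ∈ M.Q, M.cutoff x = θ := by
  obtain ⟨q, hq, rfl⟩ := M.exists_marginalCost_eq hθ
  have h0 := surplus_marginalCost_le hq M.zero_mem_Q
  rw [surplus_zero_right] at h0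
  obtain ⟨x, hx, hqx, h⟩ := exists_surplus_eq hθ.2 hq ⟨le_rfl, h0⟩
  refine ⟨x, hx, ?_⟩
  rcases hx.1.eq_or_lt with rfl | hx0
  · rw [le_antisymm hqx hq.1, M.marginalCost_zero, cutoff_zero]
  · rw [cutoff, div_eq_iff hx0.ne']
    exact (sub_eq_zero.1 h).symm

lemma qi_cutoff (hx : x ∈ M.Q) : M.qi (M.cutoff x) = x := by
  apply IsGreatest.csSup_eq
  refine ⟨⟨hx, sub_eq_zero.1 (M.surplus_cutoff x)⟩, fun y hy => ?_⟩
  rw [← M.cutoff_strictMonoOn.le_iff_le hy.1 hx, cutoff_le_iff hy.1 (cutoff_nonneg hx)]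
  exact (sub_eq_zero.2 hy.2).ge

lemma thetaC_cutoff (hx : x ∈ M.Q) : M.thetaC (M.cutoff x) = M.marginalCost x := by
  rw [thetaC, qi_cutoff hx]

variable (M) in
lemma thetaC_strictMonoOn : StrictMonoOn M.thetaC (Icc 0 M.θhi) := by
  intro a ha b hb hab
  obtain ⟨x, hx, rfl⟩ := M.exists_cutoff_eq ha
  obtain ⟨y, hy, rfl⟩ := M.exists_cutoff_eq hb
  rw [thetaC_cutoff hx, thetaC_cutoff hy]
  exact M.marginalCost_strictMonoOn hx hy ((M.cutoff_strictMonoOn.lt_iff_lt hx hy).1 hab)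

lemma thetaCInv_le_cutoff (hθ : θ ∈ Icc 0 M.θhi) (hx : x ∈ M.Q)
    (h : θ ≤ M.marginalCost x) : M.thetaCInv θ ≤ M.cutoff x := by
  obtain ⟨q, hq, hqθ⟩ := M.exists_marginalCost_eq hθ
  have hex : ∃ a ∈ Icc 0 M.θhi, M.thetaC a = θ :=
    ⟨M.cutoff q, cutoff_mem hq, (thetaC_cutoff hq).trans hqθ⟩
  rw [thetaCInv, ← M.thetaC_strictMonoOn.le_iff_le (Function.invFunOn_mem hex) (cutoff_mem hx),
    thetaC_cutoff hx, Function.invFunOn_eq hex]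
  exact h

/-! ### Menus -/

variable (M) in
/-- A menu of qualities offered to the agent, each paid its own value; the quality `0` is the
outside option. By compactness every type has an optimal choice. -/
structure IsMenu (D : Set ℝ) : Prop where
  isCompact : IsCompact D
  zero_mem : (0 : ℝ) ∈ D
  subset : D ⊆ M.Q

variable (M) in
/-- `x` is an optimal choice of type `θ` from the menu `D`. -/
def IsChoice (D : Set ℝ) (θ x : ℝ) : Prop := x ∈ D ∧ IsMaxOn (M.surplus θ) D x

variable (M) in
/-- The choice of type `θ` from the menu `D`, ties being broken in favour of higher quality. -/
def choice (D : Set ℝ) (θ : ℝ) : ℝ := sSup {x | M.IsChoice D θ x}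

variable (M) in
/-- The surplus that type `θ` obtains by an optimal choice from the menu `D`. -/
def indirectUtility (D : Set ℝ) (θ : ℝ) : ℝ := M.surplus θ (M.choice D θ)

variable (M) in
/-- The expected quality of the choices from the menu `D`. -/
def menuValue (D : Set ℝ) : ℝ := ∫ θ in M.θlo..M.θhi, M.f θ * M.choice D θ

variable (M) in
/-- No menu yields a higher expected quality than `D`. -/
def IsBestMenu (D : Set ℝ) : Prop := ∀ D', M.IsMenu D' → M.menuValue D' ≤ M.menuValue D

variable {D : Set ℝ}

namespace IsMenu

lemma isGreatest_choice (hD : M.IsMenu D) (θ : ℝ) :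
    IsGreatest {x | M.IsChoice D θ x} (M.choice D θ) := by
  have hcont : ContinuousOn (M.surplus θ) D := (M.surplus_continuousOn θ).mono hD.subset
  obtain ⟨x₀, hx₀, hmax⟩ := hD.isCompact.exists_isMaxOn ⟨0, hD.zero_mem⟩ hcont
  have hset : {x | M.IsChoice D θ x} = D ∩ M.surplus θ ⁻¹' Ici (M.surplus θ x₀) := by
    ext x
    exact ⟨fun hx => ⟨hx.1, hx.2 hx₀⟩,
      fun hx => ⟨hx.1, isMaxOn_iff.2 fun y hy => (isMaxOn_iff.1 hmax y hy).trans hx.2⟩⟩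
  have hcompact : IsCompact {x | M.IsChoice D θ x} := by
    refine hD.isCompact.of_isClosed_subset ?_ fun x hx => hx.1
    rw [hset]
    exact hcont.preimage_isClosed_of_isClosed hD.isCompact.isClosed isClosed_Ici
  exact hcompact.isGreatest_sSup ⟨x₀, hx₀, hmax⟩

lemma isChoice_choice (hD : M.IsMenu D) (θ : ℝ) : M.IsChoice D θ (M.choice D θ) :=
  (hD.isGreatest_choice θ).1

lemma choice_mem (hD : M.IsMenu D) (θ : ℝ) : M.choice D θ ∈ D := (hD.isChoice_choice θ).1

lemma choice_mem_Q (hD : M.IsMenu D) (θ : ℝ) : M.choice D θ ∈ M.Q := hD.subset (hD.choice_mem θ)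

lemma surplus_le_indirectUtility (hD : M.IsMenu D) (θ : ℝ) (hx : x ∈ D) :
    M.surplus θ x ≤ M.indirectUtility D θ :=
  (hD.isChoice_choice θ).2 hx

lemma indirectUtility_nonneg (hD : M.IsMenu D) (θ : ℝ) : 0 ≤ M.indirectUtility D θ :=
  M.surplus_zero_right θ ▸ hD.surplus_le_indirectUtility θ hD.zero_mem

lemma isSubgradient (hD : M.IsMenu D) : IsSubgradient (M.indirectUtility D) (M.choice D) := by
  intro a b
  have := hD.surplus_le_indirectUtility b (hD.choice_mem a)
  unfold indirectUtility surplus at *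
  linarith

lemma eq_choice_of_continuousAt (hD : M.IsMenu D) (hx : M.IsChoice D θ x)
    (hθ : ContinuousAt (M.choice D) θ) : x = M.choice D θ := by
  refine le_antisymm ((hD.isGreatest_choice θ).2 hx) ?_
  refine le_of_tendsto (hθ.tendsto.mono_left nhdsWithin_le_nhds : Filter.Tendsto _
    (nhdsWithin θ (Iio θ)) _) ?_
  filter_upwards [self_mem_nhdsWithin] with s hs
  have hs' : s < θ := hs
  have h₁ : M.surplus θ (M.choice D s) ≤ M.surplus θ x := hx.2 (hD.choice_mem s)
  have h₂ := hD.surplus_le_indirectUtility s hx.1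
  unfold indirectUtility surplus at *
  by_contra! hlt
  nlinarith [mul_pos (sub_pos.2 hs') (sub_pos.2 hlt)]

lemma choice_le (hD : M.IsMenu D) (hx : x ∈ D) (hθ : θ ≤ M.marginalCost x) :
    M.choice D θ ≤ x := by
  by_contra! hlt
  exact (hD.surplus_le_indirectUtility θ hx).not_gt
    (surplus_lt_of_le_marginalCost (hD.subset hx) (hD.choice_mem_Q θ) hθ hlt)

lemma le_choice (hD : M.IsMenu D) (hx : x ∈ D) (hθ : M.marginalCost x ≤ θ) :
    x ≤ M.choice D θ := by
  by_contra! hlt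
  exact (hD.surplus_le_indirectUtility θ hx).not_gt
    (surplus_lt_of_marginalCost_le (hD.subset hx) (hD.choice_mem_Q θ) hθ hlt)

lemma choice_marginalCost (hD : M.IsMenu D) (hx : x ∈ D) :
    M.choice D (M.marginalCost x) = x :=
  le_antisymm (hD.choice_le hx le_rfl) (hD.le_choice hx le_rfl)

end IsMenu

variable (M) in
/-- The menu offered by lower censorship with minimum standard `x`. -/
def lowerMenu (x : ℝ) : Set ℝ := insert 0 (Icc x M.qmax)

/-- The menu offered by the pass/fail test with minimum standard `x`. -/
def passMenu (x : ℝ) : Set ℝ := {0, x}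

lemma mem_lowerMenu (hy : y ∈ M.Q) (hxy : x ≤ y) : y ∈ M.lowerMenu x := Or.inr ⟨hxy, hy.2⟩

lemma isMenu_lowerMenu (hx : x ∈ M.Q) : M.IsMenu (M.lowerMenu x) where
  isCompact := isCompact_Icc.insert 0
  zero_mem := mem_insert _ _
  subset := insert_subset M.zero_mem_Q (Icc_subset_Icc_left hx.1)

lemma isMenu_passMenu (hx : x ∈ M.Q) : M.IsMenu (passMenu x) where
  isCompact := isCompact_singleton.insert 0
  zero_mem := mem_insert _ _
  subset := pair_subset M.zero_mem_Q hx

lemma passMenu_subset_lowerMenu (hx : x ∈ M.Q) : passMenu x ⊆ M.lowerMenu x :=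
  insert_subset_insert (singleton_subset_iff.2 ⟨le_rfl, hx.2⟩)

/-! ### The distribution of types -/

lemma continuous_density : Continuous (fun θ : M.Typ => M.f θ) :=
  continuousOn_iff_continuous_domRestrict.1 M.f_cont

lemma integral_F (g : ℝ → ℝ) :
    ∫ θ : M.Typ, g θ ∂M.F = ∫ θ in M.θlo..M.θhi, M.f θ * g θ := by
  rw [F, integral_withDensity_eq_integral_toReal_smul
    continuous_density.measurable.ennreal_ofReal (by simp),
    intervalIntegral.integral_of_le M.θlo_lt_θhi.le, ← integral_Icc_eq_integral_Ioc,
    ← integral_subtype_comap measurableSet_Icc]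
  refine integral_congr_ae (Filter.Eventually.of_forall fun θ => ?_)
  simp only [smul_eq_mul, ENNReal.toReal_ofReal (M.f_pos θ θ.2).le]

instance : IsFiniteMeasure M.F := by
  have hΘ : IsFiniteMeasure ((volume : Measure ℝ).comap (Subtype.val : M.Typ → ℝ)) := by
    refine ⟨?_⟩
    rw [(MeasurableEmbedding.subtype_coe measurableSet_Icc).comap_apply, image_univ,
      Subtype.range_coe]
    exact measure_Icc_lt_top
  exact isFiniteMeasure_withDensity_ofReal
    (continuous_density.integrable_of_hasCompactSupport (HasCompactSupport.of_compactSpace _)).2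

lemma ae_F_notMem_of_countable {s : Set ℝ} (hs : s.Countable) :
    ∀ᵐ θ : M.Typ ∂M.F, (θ : ℝ) ∉ s := by
  have hnull : (volume : Measure ℝ).comap (Subtype.val : M.Typ → ℝ) (Subtype.val ⁻¹' s) = 0 := by
    rw [(MeasurableEmbedding.subtype_coe measurableSet_Icc).comap_apply]
    exact measure_mono_null (image_preimage_subset _ _) (hs.measure_zero volume)
  exact (withDensity_absolutelyContinuous _ _).ae_le (measure_eq_zero_iff_ae_notMem.1 hnull)

lemma IsMenu.payoff_eq_menuValue (hD : M.IsMenu D) {q : M.Typ → ℝ}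
    (hq : ∀ᵐ θ : M.Typ ∂M.F, M.IsChoice D θ (q θ)) : M.payoff quality q = M.menuValue D := by
  rw [payoff, menuValue, ← integral_F]
  refine integral_congr_ae ?_
  filter_upwards [hq, ae_F_notMem_of_countable hD.isSubgradient.monotone.countable_not_continuousAt]
    with θ hθ hcont
  exact hD.eq_choice_of_continuousAt hθ (not_not.1 hcont)

lemma IsMenu.payoff_choice (hD : M.IsMenu D) :
    M.payoff quality (fun θ : M.Typ => M.choice D θ) = M.menuValue D :=
  hD.payoff_eq_menuValue (Filter.Eventually.of_forall fun θ => hD.isChoice_choice θ)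

/-! ### Equilibria as choices from menus -/

lemma measurable_signalSigma {α : Type*} {sig : M.Typ → α} {q : M.Typ → ℝ} (hq : Measurable q)
    (hsig : ∀ θ θ', sig θ = sig θ' → q θ = q θ') : Measurable[M.signalSigma sig] q := by
  intro B hB
  have hpre : sig ⁻¹' (sig '' (q ⁻¹' B)) = q ⁻¹' B := by
    refine Subset.antisymm ?_ (subset_preimage_image _ _)
    rintro θ ⟨θ', hθ', h⟩
    rwa [mem_preimage, ← hsig _ _ h]
  refine ⟨sig '' (q ⁻¹' B), ?_, hpre⟩
  change MeasurableSet (sig ⁻¹' (sig '' (q ⁻¹' B)))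
  rw [hpre]
  exact hq hB

lemma condExp_signalSigma {α : Type*} {sig : M.Typ → α} {q : M.Typ → ℝ} (hq : Measurable q)
    (hQ : ∀ θ, q θ ∈ M.Q) (hsig : ∀ θ θ', sig θ = sig θ' → q θ = q θ') :
    M.F[q | M.signalSigma sig] = q := by
  refine condExp_of_stronglyMeasurable (MeasurableSpace.comap_le_iff_le_map.2 le_rfl)
    (measurable_signalSigma hq hsig).stronglyMeasurable ?_
  refine Integrable.of_bound hq.aestronglyMeasurable M.qmax
    (Filter.Eventually.of_forall fun θ => ?_)
  rw [Real.norm_of_nonneg (hQ θ).1]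
  exact (hQ θ).2

section Equilibrium

variable {S : Type*} {π : ℝ → S} {q : M.Typ → ℝ} {takes : M.Typ → Bool} {ω : Option S → ℝ}

namespace IsEquilibrium

lemma quality_le (h : M.IsEquilibrium π q takes ω) (θ : M.Typ) (t : Bool) (hx : x ∈ M.Q)
    (hsig : signal π x t = signal π (q θ) (takes θ)) : q θ ≤ x := by
  have := h.optimal θ x hx t
  rw [hsig] at this
  exact (M.c_strictMonoOn.le_iff_le (h.mem θ) hx).1 (by linarith)

/-- Otherwise some type could obtain the same signal with less quality. -/
lemma wage_ae_eq (h : M.IsEquilibrium π q takes ω) :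
    ∀ᵐ θ : M.Typ ∂M.F, ω (signal π (q θ) (takes θ)) = q θ := by
  have := h.bayes
  rwa [condExp_signalSigma h.measurable h.mem fun θ θ' hs => le_antisymm
    (h.quality_le θ _ (h.mem θ') hs.symm) (h.quality_le θ' _ (h.mem θ) hs)] at this

lemma zero_le_payoff (h : M.IsEquilibrium π q takes ω) (θ : M.Typ) :
    0 ≤ θ * ω (signal π (q θ) (takes θ)) - M.c (q θ) :=
  calc 0 ≤ (θ : ℝ) * ω (signal π 0 false) - M.c 0 := by
        rw [M.c_zero, sub_zero]
        exact mul_nonneg (M.θlo_nonneg.trans θ.2.1) h.wage_null.1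
    _ ≤ _ := h.optimal θ 0 M.zero_mem_Q false

lemma exists_isMenu (h : M.IsEquilibrium π q takes ω) :
    ∃ D, M.IsMenu D ∧ M.payoff quality q = M.menuValue D := by
  set A : Set ℝ := q '' {θ | ω (signal π (q θ) (takes θ)) = q θ}
  have hAQ : closure A ⊆ M.Q := by
    refine closure_minimal ?_ M.isCompact_Q.isClosed
    rintro _ ⟨θ, -, rfl⟩
    exact h.mem θ
  have hD : M.IsMenu (insert 0 (closure A)) :=
    ⟨(M.isCompact_Q.of_isClosed_subset isClosed_closure hAQ).insert 0, mem_insert _ _,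
      insert_subset M.zero_mem_Q hAQ⟩
  refine ⟨_, hD, hD.payoff_eq_menuValue ?_⟩
  filter_upwards [h.wage_ae_eq] with θ hθ
  refine ⟨Or.inr (subset_closure ⟨θ, hθ, rfl⟩), ?_⟩
  rintro y (rfl | hy)
  · have := h.zero_le_payoff θ
    rwa [hθ, ← surplus, ← M.surplus_zero_right θ] at this
  · have hmaps : MapsTo (M.surplus θ) A (Iic (M.surplus θ (q θ))) := by
      rintro _ ⟨θ', hθ', rfl⟩
      have := h.optimal θ (q θ') (h.mem θ') (takes θ')
      rwa [hθ, show ω _ = _ from hθ'] at this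
    have := hmaps.closure_of_continuousOn ((M.surplus_continuousOn θ).mono hAQ) hy
    rwa [isClosed_Iic.closure_eq] at this

end IsEquilibrium

variable (M) in
/-- `D` consists of the least quality at each score of the rating `π`. An agent who takes the test
obtains his score in the cheapest way, so `D` is the menu from which `π` makes him choose. -/
structure Represents (π : ℝ → S) (D : Set ℝ) : Prop where
  exists_mem : ∀ x ∈ M.Q, ∃ d ∈ D, π d = π x
  le : ∀ d ∈ D, ∀ x ∈ M.Q, π x = π d → d ≤ x

namespace Represents

lemma exists_wage (h : M.Represents π D) (hD : M.IsMenu D) :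
    ∃ ω : Option S → ℝ, ω none = 0 ∧ ∀ d ∈ D, ω (some (π d)) = d := by
  refine ⟨fun s => s.elim 0 fun s => sInf {d ∈ D | π d = s}, rfl, fun d hd => ?_⟩
  exact IsLeast.csInf_eq ⟨⟨hd, rfl⟩, fun y hy => h.le d hd y (hD.subset hy.1) hy.2⟩

lemma induces_choice (h : M.Represents π D) (hD : M.IsMenu D) :
    M.Induces π (fun θ : M.Typ => M.choice D θ) := by
  obtain ⟨ω, hω0, hω⟩ := h.exists_wage hD
  have hωchoice : ∀ θ, ω (signal π (M.choice D θ) true) = M.choice D θ :=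
    fun θ => hω _ (hD.choice_mem θ)
  have hmeas : Measurable fun θ : M.Typ => M.choice D θ :=
    hD.isSubgradient.monotone.measurable.comp measurable_subtype_coe
  refine ⟨fun _ => true, ω, hmeas, fun θ => hD.choice_mem_Q θ, ?_, fun x hx => ?_, ?_, ?_⟩
  · have hsig : ∀ θ θ' : M.Typ, signal π (M.choice D θ) true = signal π (M.choice D θ') true →
        M.choice D θ = M.choice D θ' := fun θ θ' hs => by rw [← hωchoice θ, hs, hωchoice]
    rw [condExp_signalSigma hmeas (fun θ => hD.choice_mem_Q θ) hsig]
    simp only [hωchoice, Filter.EventuallyEq.refl]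
  · obtain ⟨d, hd, hdx⟩ := h.exists_mem x hx
    rw [← hdx, hω d hd]
    exact subset_convexHull ℝ _ ⟨hD.subset hd, rfl⟩
  · exact hω0 ▸ M.zero_mem_Q
  · intro θ x hx t
    rw [hωchoice]
    cases t with
    | true =>
      obtain ⟨d, hd, hdx⟩ := h.exists_mem x hx
      have hwage : ω (signal π x true) = d := by rw [← hω d hd, hdx]; rfl
      have hcost := M.c_strictMonoOn.monotoneOn (hD.subset hd) hx (h.le d hd x hx hdx.symm)
      rw [hwage]
      exact (sub_le_sub_left hcost _).trans (hD.surplus_le_indirectUtility θ hd)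
    | false =>
      have hcost := M.c_strictMonoOn.monotoneOn M.zero_mem_Q hx hx.1
      have hwage : ω (signal π x false) = 0 := hω0
      rw [hwage]
      exact (sub_le_sub_left hcost _).trans (hD.surplus_le_indirectUtility θ hD.zero_mem)

lemma payoff_eq_menuValue (h : M.Represents π D) (hD : M.IsMenu D) (hq : M.Induces π q) :
    M.payoff quality q = M.menuValue D := by
  obtain ⟨takes, ω, heq⟩ := hq
  refine hD.payoff_eq_menuValue ?_
  filter_upwards [heq.wage_ae_eq] with θ hθ
  refine ⟨?_, fun y hy => ?_⟩
  · cases ht : takes θ with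
    | true =>
      obtain ⟨d, hd, hdq⟩ := h.exists_mem (q θ) (heq.mem θ)
      have hqd : q θ ≤ d := heq.quality_le θ true (hD.subset hd) (by simp [signal, ht, hdq])
      rwa [hqd.antisymm (h.le d hd _ (heq.mem θ) hdq.symm)]
    | false =>
      have hq0 : q θ ≤ 0 := heq.quality_le θ false M.zero_mem_Q (by simp [signal, ht])
      rw [hq0.antisymm (heq.mem θ).1]
      exact hD.zero_mem
  · have hwage : y ≤ ω (some (π y)) :=
      convexHull_min (fun z hz => h.le y hy z hz.1 hz.2) (convex_Ici y)
        (heq.wage_score y (hD.subset hy))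
    have hopt := heq.optimal θ y (hD.subset hy) true
    rw [hθ] at hopt
    exact (sub_le_sub_right (mul_le_mul_of_nonneg_left hwage
      (M.θlo_nonneg.trans θ.2.1)) _).trans hopt

end Represents

end Equilibrium

lemma IsMenu.represents_sSup_inter_Iic (hD : M.IsMenu D) :
    M.Represents (fun x => sSup (D ∩ Iic x)) D := by
  have hfix : ∀ d ∈ D, sSup (D ∩ Iic d) = d := fun d hd =>
    IsGreatest.csSup_eq ⟨⟨hd, self_mem_Iic⟩, fun y hy => hy.2⟩
  have hmem : ∀ x ∈ M.Q, sSup (D ∩ Iic x) ∈ D ∩ Iic x := fun x hx =>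
    (hD.isCompact.inter_right isClosed_Iic).sSup_mem ⟨0, hD.zero_mem, hx.1⟩
  refine ⟨fun x hx => ⟨_, (hmem x hx).1, hfix _ (hmem x hx).1⟩, fun d hd x hx hxd => ?_⟩
  calc d = sSup (D ∩ Iic x) := (hxd.trans (hfix d hd)).symm
    _ ≤ x := (hmem x hx).2

lemma represents_lowerCensorship (x : ℝ) :
    M.Represents (lowerCensorship x) (M.lowerMenu x) := by
  refine ⟨fun y hy => ?_, ?_⟩
  · by_cases hxy : x ≤ y
    · exact ⟨y, mem_lowerMenu hy hxy, rfl⟩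
    · exact ⟨0, mem_insert _ _, by simp [lowerCensorship, hxy, hy.1.trans_lt (not_le.1 hxy)]⟩
  · rintro d (rfl | hd) z hz hzd
    · exact hz.1
    · by_cases hxz : x ≤ z <;> simp_all [lowerCensorship, hd.1]

lemma represents_passFail (x : ℝ) : M.Represents (passFail x) (passMenu x) := by
  refine ⟨fun y hy => ?_, ?_⟩
  · by_cases hxy : x ≤ y
    · exact ⟨x, mem_insert_of_mem _ rfl, by simp [passFail, hxy]⟩
    · exact ⟨0, mem_insert _ _, by simp [passFail, hxy, hy.1.trans_lt (not_le.1 hxy)]⟩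
  · rintro d (rfl | rfl) z hz hzd
    · exact hz.1
    · simpa [passFail] using hzd

section Optimality

variable {S : Type*} {π : ℝ → S} {q : M.Typ → ℝ}

lemma Represents.isOptimal_choice (h : M.Represents π D) (hD : M.IsMenu D)
    (hbest : M.IsBestMenu D) : M.IsOptimal quality π (fun θ : M.Typ => M.choice D θ) := by
  refine ⟨h.induces_choice hD, fun S' π' q' ⟨takes, ω, heq⟩ => ?_⟩
  obtain ⟨D', hD', hpay⟩ := heq.exists_isMenu
  rw [hpay, hD.payoff_choice]
  exact hbest D' hD'

lemma Represents.isBestMenu (h : M.Represents π D) (hD : M.IsMenu D)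
    (hq : M.IsOptimal quality π q) : M.IsBestMenu D := by
  intro D' hD'
  rw [← hD'.payoff_choice, ← h.payoff_eq_menuValue hD hq.1]
  exact hq.2 _ _ _ (hD'.represents_sSup_inter_Iic.induces_choice hD')

end Optimality

/-! ### Menus that cross at a mode -/

lemma Unimodal.quasiconcaveOn (h : M.Unimodal) :
    QuasiconcaveOn ℝ (Icc M.θlo M.θhi) M.f := by
  obtain ⟨m, -, hmono, hanti⟩ := h
  refine fun t => convex_iff_ordConnected.2 ⟨fun x hx y hy z hz => ?_⟩
  have hzΘ : z ∈ Icc M.θlo M.θhi := ⟨hx.1.1.trans hz.1, hz.2.trans hy.1.2⟩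
  refine ⟨hzΘ, ?_⟩
  rcases le_total z m with hzm | hmz
  · exact hx.2.trans (hmono ⟨hx.1.1, hz.1.trans hzm⟩ ⟨hzΘ.1, hzm⟩ hz.1)
  · exact hy.2.trans (hanti ⟨hmz, hzΘ.2⟩ ⟨hmz.trans hz.2, hy.1.2⟩ hz.2)

variable (M) in
lemma exists_isMode : ∃ m, M.IsMode m := by
  obtain ⟨m, hm, hmax⟩ := isCompact_Icc.exists_isMaxOn
    (nonempty_Icc.2 M.θlo_lt_θhi.le) M.f_cont
  exact ⟨m, hm, fun θ hθ => hmax hθ⟩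

lemma unimodal_of_monotoneOn (h : MonotoneOn M.f (Icc M.θlo M.θhi)) : M.Unimodal :=
  ⟨M.θhi, right_mem_Icc.2 M.θlo_lt_θhi.le, h, by simp⟩

lemma unimodal_of_antitoneOn (h : AntitoneOn M.f (Icc M.θlo M.θhi)) : M.Unimodal :=
  ⟨M.θlo, left_mem_Icc.2 M.θlo_lt_θhi.le, by simp, h⟩

lemma isMode_θhi (h : MonotoneOn M.f (Icc M.θlo M.θhi)) : M.IsMode M.θhi :=
  have hhi := right_mem_Icc.2 M.θlo_lt_θhi.le
  ⟨hhi, fun _ hθ => h hθ hhi hθ.2⟩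

lemma isMode_θlo (h : AntitoneOn M.f (Icc M.θlo M.θhi)) : M.IsMode M.θlo :=
  have hlo := left_mem_Icc.2 M.θlo_lt_θhi.le
  ⟨hlo, fun _ hθ => h hlo hθ hθ.1⟩

lemma IsMode.mem_Icc_zero {m : ℝ} (hm : M.IsMode m) : m ∈ Icc 0 M.θhi :=
  Icc_subset_Icc_left M.θlo_nonneg hm.1

variable {D' : Set ℝ} {m : ℝ}

lemma IsMenu.menuValue_eq (hD : M.IsMenu D) (hm : M.IsMode m) {l r : ℝ → ℝ}
    (h : IsSuperlevelBounds M.f M.θlo M.θhi m l r) :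
    M.menuValue D =
      ∫ t in 0..M.f m, (M.indirectUtility D (r t) - M.indirectUtility D (l t)) :=
  h.integral_mul_eq M.f_cont (fun x hx => (M.f_pos x hx).le) hm.2 hm.1 hD.isSubgradient
    fun x _ => (hD.choice_mem_Q x).1

lemma IsMenu.intervalIntegrable (hD : M.IsMenu D) (hm : M.IsMode m) {l r : ℝ → ℝ}
    (h : IsSuperlevelBounds M.f M.θlo M.θhi m l r) :
    IntervalIntegrable (fun t => M.indirectUtility D (r t) - M.indirectUtility D (l t)) volume
      0 (M.f m) :=
  h.intervalIntegrable (M.f_pos m hm.1).le hD.isSubgradient fun x _ => (hD.choice_mem_Q x).1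

variable (M) in
/-- Replacing the menu `D` by `D'` hurts the types below `m` and benefits the types above `m`. -/
structure Crosses (m : ℝ) (D D' : Set ℝ) : Prop where
  le_of_le : ∀ θ ≤ m, M.indirectUtility D' θ ≤ M.indirectUtility D θ
  le_of_ge : ∀ θ, m ≤ θ → M.indirectUtility D θ ≤ M.indirectUtility D' θ

namespace Crosses

lemma sub_le_sub (h : M.Crosses m D D') {l r : ℝ} (hl : l ≤ m) (hr : m ≤ r) :
    M.indirectUtility D r - M.indirectUtility D l ≤
      M.indirectUtility D' r - M.indirectUtility D' l :=
  _root_.sub_le_sub (h.le_of_ge r hr) (h.le_of_le l hl)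

lemma menuValue_le (h : M.Crosses m D D') (hD : M.IsMenu D) (hD' : M.IsMenu D')
    (hf : M.Unimodal) (hm : M.IsMode m) : M.menuValue D ≤ M.menuValue D' := by
  obtain ⟨l, r, hlr⟩ := exists_isSuperlevelBounds M.f_cont hf.quasiconcaveOn hm.1
  have hfm : 0 ≤ M.f m := (M.f_pos m hm.1).le
  rw [hD.menuValue_eq hm hlr, hD'.menuValue_eq hm hlr]
  refine intervalIntegral.integral_mono_on hfm (hD.intervalIntegrable hm hlr)
    (hD'.intervalIntegrable hm hlr) fun t ht => ?_
  obtain ⟨hl, hr, -⟩ := hlr t ht.2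
  exact h.sub_le_sub hl.2 hr.1

lemma menuValue_lt (h : M.Crosses m D D') (hD : M.IsMenu D) (hD' : M.IsMenu D')
    (hf : M.Unimodal) (hm : M.IsMode m) {a : ℝ} (ha : a ∈ Icc M.θlo M.θhi)
    (ham : M.f a < M.f m)
    (hne : ∀ θ ∈ uIoo m a, M.indirectUtility D θ ≠ M.indirectUtility D' θ) :
    M.menuValue D < M.menuValue D' := by
  obtain ⟨l, r, hlr⟩ := exists_isSuperlevelBounds M.f_cont hf.quasiconcaveOn hm.1
  have hfa : 0 < M.f a := M.f_pos a ha
  have hfm : 0 ≤ M.f m := (hfa.trans ham).le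
  rw [hD.menuValue_eq hm hlr, hD'.menuValue_eq hm hlr]
  refine intervalIntegral.integral_lt_integral_of_ae_le_of_measure_setOfPred_lt_ne_zero hfm
    (hD.intervalIntegrable hm hlr) (hD'.intervalIntegrable hm hlr) ?_ ?_
  · filter_upwards [ae_restrict_mem measurableSet_Ioc] with t ht
    obtain ⟨hl, hr, -⟩ := hlr t ht.2
    exact h.sub_le_sub hl.2 hr.1
  · rw [Measure.restrict_apply' measurableSet_Ioc]
    refine ((Measure.measure_Ioo_pos volume).2 ham).trans_le (measure_mono fun t ht => ?_) |>.ne'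
    obtain ⟨hl, hr, -⟩ := hlr t ht.2.le
    suffices hlt : M.indirectUtility D (r t) - M.indirectUtility D (l t) <
        M.indirectUtility D' (r t) - M.indirectUtility D' (l t) from
      ⟨hlt, hfa.trans ht.1, ht.2.le⟩
    rcases hlr.mem_uIoo M.f_cont hm.1 ha ht with hmem | hmem
    · linarith [h.le_of_ge _ hr.1, (h.le_of_le _ hl.2).lt_of_ne' (hne _ hmem)]
    · linarith [(h.le_of_ge _ hr.1).lt_of_ne (hne _ hmem), h.le_of_le _ hl.2]

end Crosses

/-! ### Best menus of lower censorship -/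

lemma indirectUtility_lowerMenu (hx : x ∈ M.Q) (hθ : θ ≤ M.marginalCost x) :
    M.indirectUtility (M.lowerMenu x) θ = max 0 (M.surplus θ x) := by
  have hD := isMenu_lowerMenu hx
  have hxD := mem_lowerMenu hx le_rfl
  refine le_antisymm ?_ (max_le (hD.indirectUtility_nonneg θ) (hD.surplus_le_indirectUtility θ hxD))
  rcases hD.choice_mem θ with h | h
  · rw [indirectUtility, h, surplus_zero_right]
    exact le_max_left _ _
  · rw [indirectUtility, (hD.choice_le hxD hθ).antisymm h.1]
    exact le_max_right _ _

lemma crosses_lowerMenu (hD : M.IsMenu D) (hx : x ∈ M.Q) (hm : m ≤ M.marginalCost x)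
    (hmx : M.surplus m x = M.indirectUtility D m) : M.Crosses m D (M.lowerMenu x) := by
  have hchoice : M.choice D m ≤ x := by
    by_contra! hlt
    exact (surplus_lt_of_le_marginalCost hx (hD.choice_mem_Q m) hm hlt).ne hmx.symm
  refine ⟨fun θ hθ => ?_, fun θ hθ => ?_⟩
  · rw [indirectUtility_lowerMenu hx (hθ.trans hm)]
    refine max_le (hD.indirectUtility_nonneg θ) (le_trans ?_ (hD.isSubgradient m θ))
    rw [← hmx]
    unfold surplus
    linarith [mul_nonneg (sub_nonneg.2 hchoice) (sub_nonneg.2 hθ)]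
  · have hD' := isMenu_lowerMenu hx
    rcases le_total x (M.choice D θ) with hle | hle
    · exact hD'.surplus_le_indirectUtility θ (mem_lowerMenu (hD.choice_mem_Q θ) hle)
    · refine le_trans ?_ (hD'.surplus_le_indirectUtility θ (mem_lowerMenu hx le_rfl))
      have := hD.isSubgradient θ m
      rw [← hmx] at this
      unfold surplus at *
      linarith [mul_nonneg (sub_nonneg.2 hle) (sub_nonneg.2 hθ)]

lemma exists_crosses_lowerMenu (hD : M.IsMenu D) (hm : m ∈ Icc 0 M.θhi) :
    ∃ x ∈ M.Q, m ≤ M.marginalCost x ∧ M.cutoff x ≤ m ∧ M.Crosses m D (M.lowerMenu x) := by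
  obtain ⟨q, hq, rfl⟩ := M.exists_marginalCost_eq hm
  obtain ⟨x, hx, hqx, hsur⟩ := exists_surplus_eq hm.2 hq (u := M.indirectUtility D _)
    ⟨hD.indirectUtility_nonneg _, surplus_marginalCost_le hq (hD.choice_mem_Q _)⟩
  have hmc := M.marginalCost_strictMonoOn.monotoneOn hq hx hqx
  exact ⟨x, hx, hmc, (cutoff_le_iff hx hm.1).2 (hsur ▸ hD.indirectUtility_nonneg _),
    crosses_lowerMenu hD hx hmc hsur⟩

lemma indirectUtility_lowerMenu_le (hx : x ∈ M.Q) (hy : y ∈ M.Q) (hθ : 0 ≤ θ) :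
    M.indirectUtility (M.lowerMenu x) θ ≤
      M.indirectUtility (M.lowerMenu y) θ + |M.c x - M.c y| := by
  have hx' := isMenu_lowerMenu hx
  have hy' := isMenu_lowerMenu hy
  set q := M.choice (M.lowerMenu x) θ with hq
  have hqQ : q ∈ M.Q := hx'.choice_mem_Q θ
  have habs := abs_nonneg (M.c x - M.c y)
  rcases hx'.choice_mem θ with h | h
  · rw [indirectUtility, h, surplus_zero_right]
    exact add_nonneg (hy'.indirectUtility_nonneg θ) habs
  rw [indirectUtility, ← hq]
  rcases le_total y q with hyq | hqy
  · linarith [hy'.surplus_le_indirectUtility θ (mem_lowerMenu hqQ hyq)]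
  · have hmem := hy'.surplus_le_indirectUtility θ (mem_lowerMenu hy le_rfl)
    have hc := M.c_strictMonoOn.monotoneOn hx hqQ h.1
    unfold surplus at *
    linarith [mul_le_mul_of_nonneg_left hqy hθ, neg_le_abs (M.c x - M.c y)]

lemma abs_indirectUtility_lowerMenu_sub_le (hx : x ∈ M.Q) (hy : y ∈ M.Q) (hθ : 0 ≤ θ) :
    |M.indirectUtility (M.lowerMenu x) θ - M.indirectUtility (M.lowerMenu y) θ| ≤
      |M.c x - M.c y| :=
  abs_sub_le_iff.2 ⟨sub_le_iff_le_add'.2 (indirectUtility_lowerMenu_le hx hy hθ),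
    sub_le_iff_le_add'.2 (abs_sub_comm (M.c x) _ ▸ indirectUtility_lowerMenu_le hy hx hθ)⟩

lemma abs_menuValue_sub_le (hf : M.Unimodal) (hm : M.IsMode m) (hD : M.IsMenu D)
    (hD' : M.IsMenu D') {ε : ℝ}
    (h : ∀ θ ∈ Icc M.θlo M.θhi, |M.indirectUtility D θ - M.indirectUtility D' θ| ≤ ε) :
    |M.menuValue D - M.menuValue D'| ≤ (ε + ε) * M.f m := by
  obtain ⟨l, r, hlr⟩ := exists_isSuperlevelBounds M.f_cont hf.quasiconcaveOn hm.1
  have hfm : 0 ≤ M.f m := (M.f_pos m hm.1).le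
  rw [hD.menuValue_eq hm hlr, hD'.menuValue_eq hm hlr,
    ← intervalIntegral.integral_sub (hD.intervalIntegrable hm hlr)
      (hD'.intervalIntegrable hm hlr), ← Real.norm_eq_abs]
  refine (intervalIntegral.norm_integral_le_of_norm_le_const (C := ε + ε) fun t ht => ?_).trans_eq
    (by rw [sub_zero, abs_of_nonneg hfm])
  rw [uIoc_of_le hfm] at ht
  obtain ⟨hl, hr, -⟩ := hlr t ht.2
  rw [Real.norm_eq_abs, sub_sub_sub_comm]
  exact (abs_sub _ _).trans (add_le_add (h _ ⟨hm.1.1.trans hr.1, hr.2⟩)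
    (h _ ⟨hl.1, hl.2.trans hm.1.2⟩))

lemma Unimodal.continuousOn_menuValue_lowerMenu (hf : M.Unimodal) :
    ContinuousOn (fun x => M.menuValue (M.lowerMenu x)) M.Q := by
  obtain ⟨m, hm⟩ := M.exists_isMode
  intro x hx
  refine tendsto_iff_dist_tendsto_zero.2 (squeeze_zero' (.of_forall fun _ => dist_nonneg)
    (g := fun y => (dist (M.c y) (M.c x) + dist (M.c y) (M.c x)) * M.f m) ?_ ?_)
  · filter_upwards [self_mem_nhdsWithin] with y hy
    exact abs_menuValue_sub_le hf hm (isMenu_lowerMenu hy) (isMenu_lowerMenu hx) fun θ hθ =>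
      abs_indirectUtility_lowerMenu_sub_le hy hx (M.θlo_nonneg.trans hθ.1)
  · have h := tendsto_iff_dist_tendsto_zero.1 (M.c_continuousOn x hx)
    simpa using (h.add h).mul_const (M.f m)

lemma Unimodal.exists_isBestMenu_lowerMenu (hf : M.Unimodal) (hm : M.IsMode m) :
    ∃ x ∈ M.Q, m ≤ M.marginalCost x ∧ M.cutoff x ≤ m ∧ M.IsBestMenu (M.lowerMenu x) := by
  obtain ⟨z, hz, hmax⟩ := M.isCompact_Q.exists_isMaxOn ⟨0, M.zero_mem_Q⟩
    hf.continuousOn_menuValue_lowerMenu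
  have hcross {D} (hD : M.IsMenu D) := exists_crosses_lowerMenu hD hm.mem_Icc_zero
  have hle {D x} (hD : M.IsMenu D) (hx : x ∈ M.Q) (h : M.Crosses m D (M.lowerMenu x)) :=
    h.menuValue_le hD (isMenu_lowerMenu hx) hf hm
  obtain ⟨x, hx, hmc, hcut, hzx⟩ := hcross (isMenu_lowerMenu hz)
  refine ⟨x, hx, hmc, hcut, fun D hD => ?_⟩
  obtain ⟨y, hy, -, -, hDy⟩ := hcross hD
  calc M.menuValue D ≤ M.menuValue (M.lowerMenu y) := hle hD hy hDy
    _ ≤ M.menuValue (M.lowerMenu z) := hmax hy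
    _ ≤ M.menuValue (M.lowerMenu x) := hle (isMenu_lowerMenu hz) hx hzx

/-! ### Comparisons type by type -/

lemma IsMenu.intervalIntegrable_mul_choice (hD : M.IsMenu D) :
    IntervalIntegrable (fun θ => M.f θ * M.choice D θ) volume M.θlo M.θhi :=
  hD.isSubgradient.monotone.intervalIntegrable.continuousOn_mul
    (by rw [uIcc_of_le M.θlo_lt_θhi.le]; exact M.f_cont)

lemma menuValue_le_of_choice_le (hD : M.IsMenu D) (hD' : M.IsMenu D')
    (h : ∀ θ ∈ Icc M.θlo M.θhi, M.choice D θ ≤ M.choice D' θ) :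
    M.menuValue D ≤ M.menuValue D' :=
  intervalIntegral.integral_mono_on M.θlo_lt_θhi.le hD.intervalIntegrable_mul_choice
    hD'.intervalIntegrable_mul_choice fun θ hθ =>
      mul_le_mul_of_nonneg_left (h θ hθ) (M.f_pos θ hθ).le

lemma menuValue_lt_of_choice_lt (hD : M.IsMenu D) (hD' : M.IsMenu D')
    (h : ∀ θ ∈ Icc M.θlo M.θhi, M.choice D θ ≤ M.choice D' θ) {b : ℝ} (hb : b ∈ Ioc M.θlo M.θhi)
    (hlt : ∀ θ ∈ Ioo M.θlo b, M.choice D θ < M.choice D' θ) :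
    M.menuValue D < M.menuValue D' := by
  refine intervalIntegral.integral_lt_integral_of_ae_le_of_measure_setOfPred_lt_ne_zero
    M.θlo_lt_θhi.le hD.intervalIntegrable_mul_choice hD'.intervalIntegrable_mul_choice ?_ ?_
  · filter_upwards [ae_restrict_mem measurableSet_Ioc] with θ hθ
    exact mul_le_mul_of_nonneg_left (h θ (Ioc_subset_Icc_self hθ))
      (M.f_pos θ (Ioc_subset_Icc_self hθ)).le
  · rw [Measure.restrict_apply' measurableSet_Ioc]
    refine ((Measure.measure_Ioo_pos volume).2 hb.1).trans_le (measure_mono fun θ hθ => ?_) |>.ne'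
    have hθΘ : θ ∈ Ioc M.θlo M.θhi := ⟨hθ.1, hθ.2.le.trans hb.2⟩
    exact ⟨mul_lt_mul_of_pos_left (hlt θ hθ) (M.f_pos θ (Ioc_subset_Icc_self hθΘ)), hθΘ⟩

lemma IsMenu.choice_le_choice (hD : M.IsMenu D) (hD' : M.IsMenu D')
    (h : M.choice D θ ∈ D') (h' : M.choice D' θ ∈ D) : M.choice D θ ≤ M.choice D' θ :=
  (hD'.isGreatest_choice θ).2 ⟨h, isMaxOn_iff.2 fun _ hy =>
    (hD'.surplus_le_indirectUtility θ hy).trans (hD.surplus_le_indirectUtility θ h')⟩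

lemma IsMenu.le_choice_of_cutoff_le (hD : M.IsMenu D) (hsub : D ⊆ M.lowerMenu x) (hx : x ∈ D)
    (hθ : 0 ≤ θ) (h : M.cutoff x ≤ θ) : x ≤ M.choice D θ := by
  rcases hsub (hD.choice_mem θ) with h0 | hle
  · refine (hD.isGreatest_choice θ).2 ⟨hx, isMaxOn_iff.2 fun y hy => ?_⟩
    calc M.surplus θ y ≤ M.surplus θ (M.choice D θ) := hD.surplus_le_indirectUtility θ hy
      _ = 0 := by rw [h0, surplus_zero_right]
      _ ≤ M.surplus θ x := (cutoff_le_iff (hD.subset hx) hθ).1 h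
  · exact hle.1

lemma le_choice_lowerMenu (hx : x ∈ M.Q) (hθ : 0 ≤ θ) (h : M.cutoff x ≤ θ) :
    x ≤ M.choice (M.lowerMenu x) θ :=
  (isMenu_lowerMenu hx).le_choice_of_cutoff_le subset_rfl (mem_lowerMenu hx le_rfl) hθ h

lemma choice_lowerMenu_pos (hx : x ∈ M.Q) (hθ : θ ∈ Ioc 0 M.θhi) (h : M.cutoff x ≤ θ) :
    0 < M.choice (M.lowerMenu x) θ := by
  rcases hx.1.eq_or_lt with rfl | hx0
  · obtain ⟨q, hq, rfl⟩ := M.exists_marginalCost_eq (Ioc_subset_Icc_self hθ)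
    rw [(isMenu_lowerMenu hx).choice_marginalCost (mem_lowerMenu hq hq.1)]
    refine hq.1.lt_of_ne' ?_
    rintro rfl
    exact hθ.1.ne' M.marginalCost_zero
  · exact hx0.trans_le (le_choice_lowerMenu hx hθ.1.le h)

lemma choice_lowerMenu_mono (hx : x ∈ M.Q) (hy : y ∈ M.Q) (hxy : x ≤ y) (hθ : 0 ≤ θ)
    (h : M.cutoff y ≤ θ) : M.choice (M.lowerMenu x) θ ≤ M.choice (M.lowerMenu y) θ := by
  have hx' := isMenu_lowerMenu hx
  have hy' := isMenu_lowerMenu hy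
  have hle := le_choice_lowerMenu hy hθ h
  rcases le_total (M.choice (M.lowerMenu x) θ) y with hlt | hge
  · exact hlt.trans hle
  · exact hx'.choice_le_choice hy' (mem_lowerMenu (hx'.choice_mem_Q θ) hge)
      (mem_lowerMenu (hy'.choice_mem_Q θ) (hxy.trans hle))

lemma menuValue_lowerMenu_mono (hx : x ∈ M.Q) (hy : y ∈ M.Q) (hxy : x ≤ y)
    (h : M.cutoff y ≤ M.θlo) : M.menuValue (M.lowerMenu x) ≤ M.menuValue (M.lowerMenu y) :=
  menuValue_le_of_choice_le (isMenu_lowerMenu hx) (isMenu_lowerMenu hy) fun _ hθ =>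
    choice_lowerMenu_mono hx hy hxy (M.θlo_nonneg.trans hθ.1) (h.trans hθ.1)

lemma θlo_le_marginalCost_of_isBestMenu (hx : x ∈ M.Q) (hbest : M.IsBestMenu (M.lowerMenu x)) :
    M.θlo ≤ M.marginalCost x := by
  by_contra! hmc
  obtain ⟨y, hy, hcut⟩ := M.exists_cutoff_eq ⟨M.θlo_nonneg, M.θlo_lt_θhi.le⟩
  have hxy : x < y := by
    rw [← M.cutoff_strictMonoOn.lt_iff_lt hx hy, hcut]
    exact (cutoff_le_marginalCost hx).trans_lt hmc
  have hmcy : M.θlo < M.marginalCost y :=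
    hcut.symm.trans_lt (cutoff_lt_marginalCost hy (hx.1.trans_lt hxy))
  refine (hbest _ (isMenu_lowerMenu hy)).not_gt (menuValue_lt_of_choice_lt (isMenu_lowerMenu hx)
    (isMenu_lowerMenu hy) (fun θ hθ => ?_) (b := min (M.marginalCost y) M.θhi)
    ⟨lt_min hmcy M.θlo_lt_θhi, min_le_right _ _⟩ fun θ hθ => ?_)
  · exact choice_lowerMenu_mono hx hy hxy.le (M.θlo_nonneg.trans hθ.1) (hcut.trans_le hθ.1)
  · have hθ0 : 0 ≤ θ := M.θlo_nonneg.trans hθ.1.le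
    obtain ⟨q, hq, rfl⟩ := M.exists_marginalCost_eq ⟨hθ0, (lt_min_iff.1 hθ.2).2.le⟩
    have hxq := (M.marginalCost_strictMonoOn.lt_iff_lt hx hq).1 (hmc.trans hθ.1)
    have hqy := (M.marginalCost_strictMonoOn.lt_iff_lt hq hy).1 (lt_min_iff.1 hθ.2).1
    rw [(isMenu_lowerMenu hx).choice_marginalCost (mem_lowerMenu hq hxq.le)]
    exact hqy.trans_le (le_choice_lowerMenu hy hθ0 (hcut.trans_le hθ.1.le))

/-! ### Pass/fail tests -/

lemma choice_le_choice_of_subset_lowerMenu (hD : M.IsMenu D) (hD' : M.IsMenu D')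
    (hsub : D ⊆ M.lowerMenu x) (hsub' : D' ⊆ M.lowerMenu x) (hx : x ∈ D') (hθ : 0 ≤ θ)
    (h : M.choice D θ ≤ x) : M.choice D θ ≤ M.choice D' θ := by
  rcases hsub (hD.choice_mem θ) with h0 | hle
  · rw [h0]
    exact (hD'.choice_mem_Q θ).1
  · rw [h.antisymm hle.1]
    refine hD'.le_choice_of_cutoff_le hsub' hx hθ ((cutoff_le_iff (hD'.subset hx) hθ).2 ?_)
    rw [← h.antisymm hle.1]
    exact hD.indirectUtility_nonneg θ

lemma menuValue_passMenu_le (hx : x ∈ M.Q) :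
    M.menuValue (passMenu x) ≤ M.menuValue (M.lowerMenu x) := by
  have hP := isMenu_passMenu hx
  refine menuValue_le_of_choice_le hP (isMenu_lowerMenu hx) fun θ hθ => ?_
  refine choice_le_choice_of_subset_lowerMenu hP (isMenu_lowerMenu hx)
    (passMenu_subset_lowerMenu hx) subset_rfl (mem_lowerMenu hx le_rfl)
    (M.θlo_nonneg.trans hθ.1) ?_
  rcases hP.choice_mem θ with h | h
  · exact h.trans_le hx.1
  · exact h.le

lemma menuValue_lowerMenu_le_passMenu (hx : x ∈ M.Q) (h : M.θhi ≤ M.marginalCost x) :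
    M.menuValue (M.lowerMenu x) ≤ M.menuValue (passMenu x) := by
  have hL := isMenu_lowerMenu hx
  refine menuValue_le_of_choice_le hL (isMenu_passMenu hx) fun θ hθ => ?_
  exact choice_le_choice_of_subset_lowerMenu hL (isMenu_passMenu hx) subset_rfl
    (passMenu_subset_lowerMenu hx) (mem_insert_of_mem _ rfl) (M.θlo_nonneg.trans hθ.1)
    (hL.choice_le (mem_lowerMenu hx le_rfl) (hθ.2.trans h))

lemma IsBestMenu.lowerMenu_of_passMenu (hx : x ∈ M.Q) (h : M.IsBestMenu (passMenu x)) :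
    M.IsBestMenu (M.lowerMenu x) :=
  fun D hD => (h D hD).trans (menuValue_passMenu_le hx)

lemma IsBestMenu.passMenu_of_lowerMenu (hx : x ∈ M.Q) (hθ : M.θhi ≤ M.marginalCost x)
    (h : M.IsBestMenu (M.lowerMenu x)) : M.IsBestMenu (passMenu x) :=
  fun D hD => (h D hD).trans (menuValue_lowerMenu_le_passMenu hx hθ)

lemma Unimodal.exists_isBestMenu_passMenu (hf : M.Unimodal) (h : M.θhi ≤ M.thetaC M.θlo) :
    ∃ x ∈ M.Q, M.IsBestMenu (passMenu x) := by
  obtain ⟨m, hm⟩ := M.exists_isMode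
  obtain ⟨x, hx, -, -, hbest⟩ := hf.exists_isBestMenu_lowerMenu hm
  obtain ⟨y, hy, hcut⟩ := M.exists_cutoff_eq ⟨M.θlo_nonneg, M.θlo_lt_θhi.le⟩
  rw [← hcut, thetaC_cutoff hy] at h
  rcases le_total y x with hyx | hxy
  · exact ⟨x, hx, hbest.passMenu_of_lowerMenu hx
      (h.trans (M.marginalCost_strictMonoOn.monotoneOn hy hx hyx))⟩
  · refine ⟨y, hy, IsBestMenu.passMenu_of_lowerMenu hy h fun D hD => ?_⟩
    exact (hbest D hD).trans (menuValue_lowerMenu_mono hx hy hxy hcut.le)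

lemma exists_isBestMenu_passMenu_of_monotoneOn (hf : MonotoneOn M.f (Icc M.θlo M.θhi)) :
    ∃ x ∈ M.Q, M.IsBestMenu (passMenu x) := by
  obtain ⟨x, hx, hmc, -, hbest⟩ :=
    (unimodal_of_monotoneOn hf).exists_isBestMenu_lowerMenu (isMode_θhi hf)
  exact ⟨x, hx, hbest.passMenu_of_lowerMenu hx hmc⟩

/-! ### Location of the optimal cutoff types -/

lemma indirectUtility_lowerMenu_eq_zero (hx : x ∈ M.Q) (hθ : 0 ≤ θ) (h : θ < M.cutoff x) :
    M.indirectUtility (M.lowerMenu x) θ = 0 := by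
  rw [indirectUtility_lowerMenu hx (h.le.trans (cutoff_le_marginalCost hx))]
  exact max_eq_left (not_le.1 (mt (cutoff_le_iff hx hθ).2 h.not_ge)).le

lemma indirectUtility_lowerMenu_pos (hx : x ∈ M.Q) (hθ : θ ≤ M.θhi) (h : M.cutoff x < θ) :
    0 < M.indirectUtility (M.lowerMenu x) θ := by
  have hL := isMenu_lowerMenu hx
  rcases hx.1.eq_or_lt with rfl | hx0
  · rw [M.cutoff_zero] at h
    obtain ⟨q, hq, rfl⟩ := M.exists_marginalCost_eq ⟨h.le, hθ⟩
    refine lt_of_lt_of_le ?_ (hL.surplus_le_indirectUtility _ (mem_lowerMenu hq hq.1))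
    rw [← M.surplus_zero_right]
    refine surplus_marginalCost_lt hq M.zero_mem_Q ?_
    rintro rfl
    exact h.ne' M.marginalCost_zero
  · refine lt_of_lt_of_le ?_ (hL.surplus_le_indirectUtility θ (mem_lowerMenu hx le_rfl))
    have h0 := M.surplus_cutoff x
    unfold surplus at *
    linarith [mul_lt_mul_of_pos_right h hx0]

lemma IsMode.of_le {a : ℝ} (hm : M.IsMode m) (ha : a ∈ Icc M.θlo M.θhi) (h : M.f m ≤ M.f a) :
    M.IsMode a :=
  ⟨ha, fun θ hθ => (hm.2 θ hθ).trans h⟩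

lemma Unimodal.isMode_cutoff_of_lt (hf : M.Unimodal) (hm : M.IsMode m) (hx : x ∈ M.Q)
    (hbest : M.IsBestMenu (M.lowerMenu x)) (h : m < M.cutoff x) : M.IsMode (M.cutoff x) := by
  have hcut : M.cutoff x ∈ Icc M.θlo M.θhi := ⟨hm.1.1.trans h.le, (cutoff_mem hx).2⟩
  refine hm.of_le hcut ?_
  by_contra! hlt
  obtain ⟨y, hy, -, hym, hcross⟩ := exists_crosses_lowerMenu (isMenu_lowerMenu hx) hm.mem_Icc_zero
  refine (hbest _ (isMenu_lowerMenu hy)).not_gt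
    (hcross.menuValue_lt (isMenu_lowerMenu hx) (isMenu_lowerMenu hy) hf hm hcut hlt fun θ hθ => ?_)
  rw [uIoo_of_le h.le] at hθ
  rw [indirectUtility_lowerMenu_eq_zero hx (hm.mem_Icc_zero.1.trans hθ.1.le) hθ.2]
  exact (indirectUtility_lowerMenu_pos hy (hθ.2.le.trans hcut.2) (hym.trans_lt hθ.1)).ne

lemma Unimodal.isMode_marginalCost_of_lt (hf : M.Unimodal) (hm : M.IsMode m) (hx : x ∈ M.Q)
    (hbest : M.IsBestMenu (M.lowerMenu x)) (h : M.marginalCost x < m) :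
    M.IsMode (M.marginalCost x) := by
  have hmc : M.marginalCost x ∈ Icc M.θlo M.θhi :=
    ⟨θlo_le_marginalCost_of_isBestMenu hx hbest, h.le.trans hm.1.2⟩
  refine hm.of_le hmc ?_
  by_contra! hlt
  have hL := isMenu_lowerMenu hx
  obtain ⟨y, hy, rfl⟩ := M.exists_marginalCost_eq hm.mem_Icc_zero
  have hxy := (M.marginalCost_strictMonoOn.lt_iff_lt hx hy).1 h
  have hcross : M.Crosses (M.marginalCost y) (M.lowerMenu x) (M.lowerMenu y) :=
    crosses_lowerMenu hL hy le_rfl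
      (by rw [indirectUtility, hL.choice_marginalCost (mem_lowerMenu hy hxy.le)])
  refine (hbest _ (isMenu_lowerMenu hy)).not_gt
    (hcross.menuValue_lt hL (isMenu_lowerMenu hy) hf hm hmc hlt fun θ hθ => ?_)
  rw [uIoo_of_ge h.le] at hθ
  have hθ0 : 0 < θ := (M.marginalCost_nonneg hx).trans_lt hθ.1
  obtain ⟨q, hq, rfl⟩ := M.exists_marginalCost_eq ⟨hθ0.le, hθ.2.le.trans hm.1.2⟩
  have hxq := (M.marginalCost_strictMonoOn.lt_iff_lt hx hq).1 hθ.1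
  have hqy := (M.marginalCost_strictMonoOn.lt_iff_lt hq hy).1 hθ.2
  have hq0 : 0 < q := hx.1.trans_lt hxq
  rw [indirectUtility, hL.choice_marginalCost (mem_lowerMenu hq hxq.le)]
  refine (surplus_marginalCost_lt hq ((isMenu_lowerMenu hy).choice_mem_Q _) ?_).ne'
  rcases (isMenu_lowerMenu hy).choice_mem (M.marginalCost q) with h0 | hle
  · rw [h0]
    exact hq0.ne'
  · exact (hqy.trans_le hle.1).ne

lemma Unimodal.exists_isMode_of_isBestMenu (hf : M.Unimodal) (hx : x ∈ M.Q)
    (hbest : M.IsBestMenu (M.lowerMenu x)) :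
    ∃ m, M.IsMode m ∧ M.cutoff x ≤ m ∧ m ≤ M.marginalCost x := by
  obtain ⟨m, hm⟩ := M.exists_isMode
  rcases lt_or_ge m (M.cutoff x) with hlt | hcut
  · exact ⟨_, hf.isMode_cutoff_of_lt hm hx hbest hlt, le_rfl, cutoff_le_marginalCost hx⟩
  rcases lt_or_ge (M.marginalCost x) m with hlt | hmc
  · exact ⟨_, hf.isMode_marginalCost_of_lt hm hx hbest hlt, cutoff_le_marginalCost hx, le_rfl⟩
  · exact ⟨m, hm, hcut, hmc⟩

/-! ### Menus with a gap -/

/-- The integrals of the choices are increments of the indirect utilities, so they agree for `D` and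
`D'`, and the density matters only up to the constant `l`. -/
lemma IsMenu.menuValue_sub_menuValue (hD : M.IsMenu D) (hD' : M.IsMenu D')
    (hlo : M.choice D M.θlo = M.choice D' M.θlo) (hhi : M.choice D M.θhi = M.choice D' M.θhi)
    (l : ℝ) : M.menuValue D - M.menuValue D' =
      ∫ θ in M.θlo..M.θhi, (M.f θ - l) * (M.choice D θ - M.choice D' θ) := by
  have hint {D : Set ℝ} (hD : M.IsMenu D) : IntervalIntegrable (M.choice D) volume M.θlo M.θhi :=
    hD.isSubgradient.monotone.intervalIntegrable
  have hsum : ∫ θ in M.θlo..M.θhi, (M.choice D θ - M.choice D' θ) = 0 := by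
    rw [intervalIntegral.integral_sub (hint hD) (hint hD'), hD.isSubgradient.integral_eq_sub,
      hD'.isSubgradient.integral_eq_sub]
    simp only [indirectUtility, hlo, hhi, sub_self]
  have hmul_const := ((hint hD).sub (hint hD')).const_mul l
  calc M.menuValue D - M.menuValue D'
      = (∫ θ in M.θlo..M.θhi, (M.f θ * M.choice D θ - M.f θ * M.choice D' θ)) -
          ∫ θ in M.θlo..M.θhi, l * (M.choice D θ - M.choice D' θ) := by
        rw [intervalIntegral.integral_const_mul, hsum, mul_zero, sub_zero]
        exact (intervalIntegral.integral_sub hD.intervalIntegrable_mul_choice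
          hD'.intervalIntegrable_mul_choice).symm
    _ = ∫ θ in M.θlo..M.θhi, (M.f θ - l) * (M.choice D θ - M.choice D' θ) := by
        rw [← intervalIntegral.integral_sub (hD.intervalIntegrable_mul_choice.sub
          hD'.intervalIntegrable_mul_choice) hmul_const]
        congr! 2 with θ
        ring

variable {y₁ y₂ t : ℝ}

variable (M) in
/-- The menu in which the qualities strictly between `y₁` and `y₂` are not offered. -/
def gapMenu (y₁ y₂ : ℝ) : Set ℝ := Icc 0 y₁ ∪ Icc y₂ M.qmax

lemma isMenu_gapMenu (hy₁ : y₁ ∈ M.Q) (hy₂ : y₂ ∈ M.Q) : M.IsMenu (M.gapMenu y₁ y₂) where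
  isCompact := isCompact_Icc.union isCompact_Icc
  zero_mem := Or.inl ⟨le_rfl, hy₁.1⟩
  subset := union_subset (Icc_subset_Icc_right hy₁.2) (Icc_subset_Icc_left hy₂.1)

lemma choice_lowerMenu_zero_marginalCost (hx : x ∈ M.Q) :
    M.choice (M.lowerMenu 0) (M.marginalCost x) = x :=
  (isMenu_lowerMenu M.zero_mem_Q).choice_marginalCost (mem_lowerMenu hx hx.1)

section Gap

variable (hy₁ : y₁ ∈ M.Q) (hy₂ : y₂ ∈ M.Q) (hy : y₁ < y₂)
  (ht : M.surplus t y₁ = M.surplus t y₂)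
include hy₁ hy₂

lemma choice_gapMenu_of_notMem_Ioo (hθ : θ ∈ Icc 0 M.θhi)
    (h : θ ∉ Ioo (M.marginalCost y₁) (M.marginalCost y₂)) :
    M.choice (M.gapMenu y₁ y₂) θ = M.choice (M.lowerMenu 0) θ := by
  obtain ⟨q, hq, rfl⟩ := M.exists_marginalCost_eq hθ
  have hmc := M.marginalCost_strictMonoOn
  rw [choice_lowerMenu_zero_marginalCost hq]
  refine (isMenu_gapMenu hy₁ hy₂).choice_marginalCost ?_
  rcases le_or_gt q y₁ with h₁ | h₁
  · exact Or.inl ⟨hq.1, h₁⟩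
  · exact Or.inr ⟨not_lt.1 fun h₂ => h ⟨hmc hy₁ hq h₁, hmc hq hy₂ h₂⟩, hq.2⟩

lemma choice_gapMenu_eq_or_eq (hθ : θ ∈ Icc (M.marginalCost y₁) (M.marginalCost y₂)) :
    M.choice (M.gapMenu y₁ y₂) θ = y₁ ∨ M.choice (M.gapMenu y₁ y₂) θ = y₂ := by
  have hG := isMenu_gapMenu hy₁ hy₂
  refine (hG.choice_mem θ).imp (fun h => h.2.antisymm ?_) fun h => h.1.antisymm' ?_
  · exact hG.le_choice (Or.inl ⟨hy₁.1, le_rfl⟩) hθ.1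
  · exact hG.choice_le (Or.inr ⟨le_rfl, hy₂.2⟩) hθ.2

include hy ht

lemma mem_Ioo_marginalCost_of_surplus_eq :
    t ∈ Ioo (M.marginalCost y₁) (M.marginalCost y₂) := by
  constructor <;> by_contra! h
  · exact (surplus_lt_of_le_marginalCost hy₁ hy₂ h hy).ne' ht
  · exact (surplus_lt_of_marginalCost_le hy₂ hy₁ h hy).ne ht

lemma choice_gapMenu_of_lt (hθ₁ : M.marginalCost y₁ ≤ θ) (hθt : θ < t) :
    M.choice (M.gapMenu y₁ y₂) θ = y₁ := by
  have htmc := mem_Ioo_marginalCost_of_surplus_eq hy₁ hy₂ hy ht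
  refine (choice_gapMenu_eq_or_eq hy₁ hy₂ ⟨hθ₁, (hθt.trans htmc.2).le⟩).resolve_right fun h => ?_
  have := (isMenu_gapMenu hy₁ hy₂).surplus_le_indirectUtility θ (Or.inl ⟨hy₁.1, le_rfl⟩)
  rw [indirectUtility, h] at this
  unfold surplus at *
  linarith [mul_lt_mul_of_pos_right hθt (sub_pos.2 hy)]

lemma choice_gapMenu_of_gt (hθt : t < θ) (hθ₂ : θ ≤ M.marginalCost y₂) :
    M.choice (M.gapMenu y₁ y₂) θ = y₂ := by
  have htmc := mem_Ioo_marginalCost_of_surplus_eq hy₁ hy₂ hy ht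
  refine (choice_gapMenu_eq_or_eq hy₁ hy₂ ⟨(htmc.1.trans hθt).le, hθ₂⟩).resolve_left fun h => ?_
  have := (isMenu_gapMenu hy₁ hy₂).surplus_le_indirectUtility θ (Or.inr ⟨le_rfl, hy₂.2⟩)
  rw [indirectUtility, h] at this
  unfold surplus at *
  linarith [mul_lt_mul_of_pos_right hθt (sub_pos.2 hy)]

lemma integral_mul_choice_gapMenu {k : ℝ → ℝ}
    (hk : ContinuousOn k (Icc (M.marginalCost y₁) (M.marginalCost y₂))) :
    ∫ θ in M.marginalCost y₁..M.marginalCost y₂, k θ * M.choice (M.gapMenu y₁ y₂) θ =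
      y₂ * (∫ θ in t..M.marginalCost y₂, k θ) - y₁ * ∫ θ in t..M.marginalCost y₁, k θ := by
  have htmc := mem_Ioo_marginalCost_of_surplus_eq hy₁ hy₂ hy ht
  have hint {a b : ℝ} (ha : M.marginalCost y₁ ≤ a) (hab : a ≤ b) (hb : b ≤ M.marginalCost y₂) :
      IntervalIntegrable (fun θ => k θ * M.choice (M.gapMenu y₁ y₂) θ) volume a b :=
    (isMenu_gapMenu hy₁ hy₂).isSubgradient.monotone.intervalIntegrable.continuousOn_mul
      (hk.mono (uIcc_of_le hab ▸ Icc_subset_Icc ha hb))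
  rw [← intervalIntegral.integral_add_adjacent_intervals (hint le_rfl htmc.1.le htmc.2.le)
      (hint htmc.1.le htmc.2.le le_rfl),
    intervalIntegral.integral_congr_Ioo_of_le (g := fun θ => k θ * y₁) htmc.1.le
      fun θ hθ => by simp only [choice_gapMenu_of_lt hy₁ hy₂ hy ht hθ.1.le hθ.2],
    intervalIntegral.integral_congr_Ioo_of_le (g := fun θ => k θ * y₂) htmc.2.le
      fun θ hθ => by simp only [choice_gapMenu_of_gt hy₁ hy₂ hy ht hθ.1 hθ.2.le],
    intervalIntegral.integral_mul_const, intervalIntegral.integral_mul_const,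
    intervalIntegral.integral_symm t]
  ring

lemma integral_mul_choice_gapMenu_sub {k : ℝ → ℝ}
    (hk : ContinuousOn k (Icc (M.marginalCost y₁) (M.marginalCost y₂))) :
    ∫ θ in M.marginalCost y₁..M.marginalCost y₂,
        k θ * (M.choice (M.gapMenu y₁ y₂) θ - M.choice (M.lowerMenu 0) θ) =
      ∫ y in y₁..y₂, ∫ θ in t..M.marginalCost y, k θ := by
  have htmc := mem_Ioo_marginalCost_of_surplus_eq hy₁ hy₂ hy ht
  have hsub : Icc y₁ y₂ ⊆ M.Q := Icc_subset_Icc hy₁.1 hy₂.2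
  have hmc : ContDiffOn ℝ 1 M.marginalCost (Icc y₁ y₂) := M.marginalCost_contDiffOn.mono hsub
  have hfull := integral_mul_leftInvOn_eq_sub hy.le
    (fun y hy' => (hmc.differentiableOn one_ne_zero y hy').hasDerivWithinAt)
    (hmc.continuousOn_derivWithin (uniqueDiffOn_Icc hy) le_rfl)
    (M.marginalCost_strictMonoOn.monotoneOn.mono hsub)
    (fun y hy' => choice_lowerMenu_zero_marginalCost (hsub hy')) hk
    (fun θ hθ => hasDerivWithinAt_integral_Icc hk (Ioo_subset_Icc_self htmc) hθ)
  have hint {D : Set ℝ} (hD : M.IsMenu D) : IntervalIntegrable (fun θ => k θ * M.choice D θ)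
      volume (M.marginalCost y₁) (M.marginalCost y₂) :=
    hD.isSubgradient.monotone.intervalIntegrable.continuousOn_mul
      ((uIcc_of_le (htmc.1.trans htmc.2).le).symm ▸ hk)
  simp only [mul_sub]
  rw [intervalIntegral.integral_sub (hint (isMenu_gapMenu hy₁ hy₂))
    (hint (isMenu_lowerMenu M.zero_mem_Q)), integral_mul_choice_gapMenu hy₁ hy₂ hy ht hk, hfull]
  ring

lemma menuValue_gapMenu_sub (hlo : M.θlo ≤ M.marginalCost y₁) (hhi : M.marginalCost y₂ ≤ M.θhi)
    (l : ℝ) :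
    M.menuValue (M.gapMenu y₁ y₂) - M.menuValue (M.lowerMenu 0) =
      ∫ y in y₁..y₂, ∫ θ in t..M.marginalCost y, (M.f θ - l) := by
  have htmc := mem_Ioo_marginalCost_of_surplus_eq hy₁ hy₂ hy ht
  have hle := (htmc.1.trans htmc.2).le
  have hchoice {θ : ℝ} (hθ : θ ∈ Icc M.θlo M.θhi)
      (h : θ ∉ Ioo (M.marginalCost y₁) (M.marginalCost y₂)) :
      M.choice (M.gapMenu y₁ y₂) θ = M.choice (M.lowerMenu 0) θ :=
    choice_gapMenu_of_notMem_Ioo hy₁ hy₂ ⟨M.θlo_nonneg.trans hθ.1, hθ.2⟩ h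
  rw [(isMenu_gapMenu hy₁ hy₂).menuValue_sub_menuValue (isMenu_lowerMenu M.zero_mem_Q)
      (hchoice (left_mem_Icc.2 M.θlo_lt_θhi.le) fun h => h.1.not_ge hlo)
      (hchoice (right_mem_Icc.2 M.θlo_lt_θhi.le) fun h => h.2.not_ge hhi) l,
    ← integral_mul_choice_gapMenu_sub (k := fun θ => M.f θ - l) hy₁ hy₂ hy ht
      ((M.f_cont.sub continuousOn_const).mono (Icc_subset_Icc hlo hhi)),
    intervalIntegral.integral_of_le M.θlo_lt_θhi.le, intervalIntegral.integral_of_le hle]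
  refine setIntegral_eq_of_subset_of_forall_sdiff_eq_zero measurableSet_Ioc
    (Ioc_subset_Ioc hlo hhi) fun θ hθ => ?_
  rw [hchoice (Ioc_subset_Icc_self hθ.1) fun h => hθ.2 (Ioo_subset_Ioc_self h), sub_self, mul_zero]

lemma menuValue_lowerMenu_zero_lt_gapMenu (hlo : M.θlo ≤ M.marginalCost y₁)
    (hhi : M.marginalCost y₂ ≤ M.θhi) {l : ℝ}
    (hnonneg : ∀ s ∈ Icc (M.marginalCost y₁) (M.marginalCost y₂), 0 ≤ ∫ θ in t..s, (M.f θ - l))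
    (hpos : 0 < (∫ θ in t..M.marginalCost y₁, (M.f θ - l)) ∨
      0 < ∫ θ in t..M.marginalCost y₂, (M.f θ - l)) :
    M.menuValue (M.lowerMenu 0) < M.menuValue (M.gapMenu y₁ y₂) := by
  rw [← sub_pos, menuValue_gapMenu_sub hy₁ hy₂ hy ht hlo hhi l]
  have hsub : Icc y₁ y₂ ⊆ M.Q := Icc_subset_Icc hy₁.1 hy₂.2
  have hmaps : MapsTo M.marginalCost (Icc y₁ y₂) (Icc (M.marginalCost y₁) (M.marginalCost y₂)) :=
    (M.marginalCost_strictMonoOn.monotoneOn.mono hsub).mapsTo_Icc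
  have htmc := Ioo_subset_Icc_self (mem_Ioo_marginalCost_of_surplus_eq hy₁ hy₂ hy ht)
  have hk : ContinuousOn (fun θ => M.f θ - l) (Icc (M.marginalCost y₁) (M.marginalCost y₂)) :=
    (M.f_cont.sub continuousOn_const).mono (Icc_subset_Icc hlo hhi)
  refine intervalIntegral.integral_pos hy (fun y hyy => ?_)
    (fun y hyy => hnonneg _ (hmaps (Ioc_subset_Icc_self hyy))) ?_
  · exact (hasDerivWithinAt_integral_Icc hk htmc (hmaps hyy)).continuousWithinAt.comp
      (M.marginalCost_continuousOn.mono hsub y hyy) hmaps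
  · exact hpos.elim (fun h => ⟨y₁, left_mem_Icc.2 hy.le, h⟩) fun h => ⟨y₂, right_mem_Icc.2 hy.le, h⟩

end Gap

/-- Starting from `yt`, one moves to either side until the surplus has dropped by the same amount,
or until one of the bounds is reached. -/
lemma exists_surplus_eq_of_lt_of_lt {ya yt yb : ℝ} (hya : ya ∈ M.Q) (hyb : yb ∈ M.Q) (hat : ya < yt)
    (htb : yt < yb) : ∃ y₁ ∈ Icc ya yt, ∃ y₂ ∈ Icc yt yb, y₁ < y₂ ∧
      M.surplus (M.marginalCost yt) y₁ = M.surplus (M.marginalCost yt) y₂ ∧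
      (y₁ = ya ∨ y₂ = yb) := by
  have hyt : yt ∈ M.Q := ⟨hya.1.trans hat.le, htb.le.trans hyb.2⟩
  have hcont := M.surplus_continuousOn (M.marginalCost yt)
  rcases le_total (M.surplus (M.marginalCost yt) ya) (M.surplus (M.marginalCost yt) yb) with h | h
  · obtain ⟨y₁, hy₁, heq⟩ := intermediate_value_Icc hat.le
      (hcont.mono (Icc_subset_Icc hya.1 hyt.2)) ⟨h, surplus_marginalCost_le hyt hyb⟩
    exact ⟨y₁, hy₁, yb, right_mem_Icc.2 htb.le, hy₁.2.trans_lt htb, heq, .inr rfl⟩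
  · obtain ⟨y₂, hy₂, heq⟩ := intermediate_value_Icc' htb.le
      (hcont.mono (Icc_subset_Icc hyt.1 hyb.2)) ⟨h, surplus_marginalCost_le hyt hya⟩
    exact ⟨ya, left_mem_Icc.2 hat.le, y₂, hy₂, hat.trans_le hy₂.1, heq.symm, .inl rfl⟩

/-- If the density increases from `a` to `b`, then a menu with a gap does better: its advantage is
the integral of a primitive of `f - l`, which is nonnegative by the choice of `l`. -/
lemma antitoneOn_of_isBestMenu (hbest : M.IsBestMenu (M.lowerMenu 0)) :
    AntitoneOn M.f (Icc M.θlo M.θhi) := by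
  intro a ha b hb hab
  by_contra! hfab
  have hΘ : Icc a b ⊆ Icc M.θlo M.θhi := Icc_subset_Icc ha.1 hb.2
  have hcont : ContinuousOn M.f (Icc a b) := M.f_cont.mono hΘ
  obtain ⟨l, t, ht, hnonneg, hta, htb⟩ := exists_forall_integral_sub_nonneg hcont
    (hab.lt_of_ne fun h => hfab.ne (congrArg M.f h)) hfab
  obtain ⟨ya, hya, rfl⟩ := M.exists_marginalCost_eq ⟨M.θlo_nonneg.trans ha.1, ha.2⟩
  obtain ⟨yb, hyb, rfl⟩ := M.exists_marginalCost_eq ⟨M.θlo_nonneg.trans hb.1, hb.2⟩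
  have htΘ := hΘ (Ioo_subset_Icc_self ht)
  obtain ⟨yt, hyt, rfl⟩ := M.exists_marginalCost_eq ⟨M.θlo_nonneg.trans htΘ.1, htΘ.2⟩
  have hmc := M.marginalCost_strictMonoOn
  obtain ⟨y₁, hy₁, y₂, hy₂, hlt, heq, hend⟩ := exists_surplus_eq_of_lt_of_lt hya hyb
    ((hmc.lt_iff_lt hya hyt).1 ht.1) ((hmc.lt_iff_lt hyt hyb).1 ht.2)
  have hy₁Q : y₁ ∈ M.Q := ⟨hya.1.trans hy₁.1, hy₁.2.trans hyt.2⟩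
  have hy₂Q : y₂ ∈ M.Q := ⟨hyt.1.trans hy₂.1, hy₂.2.trans hyb.2⟩
  have hay₁ := hmc.monotoneOn hya hy₁Q hy₁.1
  have hy₂b := hmc.monotoneOn hy₂Q hyb hy₂.2
  refine (hbest _ (isMenu_gapMenu hy₁Q hy₂Q)).not_gt <|
    menuValue_lowerMenu_zero_lt_gapMenu hy₁Q hy₂Q hlt heq (ha.1.trans hay₁) (hy₂b.trans hb.2)
      (fun s hs => hnonneg s (Icc_subset_Icc hay₁ hy₂b hs)) ?_
  rcases hend with rfl | rfl
  exacts [.inl hta, .inr htb]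

/-! ### Optimal ratings -/

lemma Unimodal.exists_isOptimal_lowerCensorship (hf : M.Unimodal) {m : ℝ} (hm : M.IsMode m) :
    ∃ x ∈ M.Q, (∃ q, M.IsOptimal quality (lowerCensorship x) q) ∧
      M.cutoff x ∈ Icc (M.thetaCInv m) m := by
  obtain ⟨x, hx, hmc, hcut, hbest⟩ := hf.exists_isBestMenu_lowerMenu hm
  exact ⟨x, hx, ⟨_, (represents_lowerCensorship x).isOptimal_choice (isMenu_lowerMenu hx) hbest⟩,
    thetaCInv_le_cutoff hm.mem_Icc_zero hx hmc, hcut⟩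

lemma IsBestMenu.exists_isOptimal_passFail (hx : x ∈ M.Q) (hbest : M.IsBestMenu (passMenu x)) :
    ∃ q, M.IsOptimal quality (passFail x) q :=
  ⟨_, (represents_passFail x).isOptimal_choice (isMenu_passMenu hx) hbest⟩

lemma exists_isOptimal_lowerCensorship_noExclusion (hf : AntitoneOn M.f (Icc M.θlo M.θhi)) :
    ∃ x ∈ M.Q, ∃ q, M.IsOptimal quality (lowerCensorship x) q ∧
      M.cutoff x ≤ M.θlo ∧ M.NoExclusion q := by
  obtain ⟨x, hx, -, hcut, hbest⟩ :=
    (unimodal_of_antitoneOn hf).exists_isBestMenu_lowerMenu (isMode_θlo hf)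
  exact ⟨x, hx, _, (represents_lowerCensorship x).isOptimal_choice (isMenu_lowerMenu hx) hbest,
    hcut, fun θ hθ => choice_lowerMenu_pos hx ⟨hθ, θ.2.2⟩ (hcut.trans θ.2.1)⟩

lemma isBestMenu_lowerMenu_zero_iff :
    M.IsBestMenu (M.lowerMenu 0) ↔ AntitoneOn M.f (Icc M.θlo M.θhi) ∧ M.θlo = 0 := by
  refine ⟨fun h => ⟨antitoneOn_of_isBestMenu h, le_antisymm ?_ M.θlo_nonneg⟩, fun ⟨h, h0⟩ => ?_⟩
  · exact (θlo_le_marginalCost_of_isBestMenu M.zero_mem_Q h).trans_eq M.marginalCost_zero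
  · obtain ⟨x, hx, -, hcut, hbest⟩ :=
      (unimodal_of_antitoneOn h).exists_isBestMenu_lowerMenu (isMode_θlo h)
    rw [h0, ← cutoff_zero (M := M), M.cutoff_strictMonoOn.le_iff_le hx M.zero_mem_Q] at hcut
    rwa [← hcut.antisymm hx.1]

lemma exists_isOptimal_fullyRevealing_iff :
    (∃ q, M.IsOptimal quality fullyRevealing q) ↔
      AntitoneOn M.f (Icc M.θlo M.θhi) ∧ M.θlo = 0 := by
  rw [← isBestMenu_lowerMenu_zero_iff]
  have hrep : M.Represents fullyRevealing (M.lowerMenu 0) := represents_lowerCensorship 0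
  have hD := isMenu_lowerMenu M.zero_mem_Q
  exact ⟨fun ⟨_, hq⟩ => hrep.isBestMenu hD hq, fun h => ⟨_, hrep.isOptimal_choice hD h⟩⟩

lemma isBestMenu_lowerMenu_of_isOptimal (hx : x ∈ M.Q)
    (hopt : (∃ q, M.IsOptimal quality (lowerCensorship x) q) ∨
      ∃ q, M.IsOptimal quality (passFail x) q) : M.IsBestMenu (M.lowerMenu x) := by
  rcases hopt with ⟨q, hq⟩ | ⟨q, hq⟩
  · exact (represents_lowerCensorship x).isBestMenu (isMenu_lowerMenu hx) hq
  · exact ((represents_passFail x).isBestMenu (isMenu_passMenu hx) hq).lowerMenu_of_passMenu hx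

end

end RatingModel

theorem mainTheorem2 (M : RatingModel) :
    -- lower censorship is optimal if the density is unimodal
    (M.Unimodal →
      ∃ q₀ ∈ M.Q, ∃ q, M.IsOptimal RatingModel.quality (RatingModel.lowerCensorship q₀) q) ∧
    -- pass/fail is optimal if the density is increasing, or the range of types is small
    ((MonotoneOn M.f (Set.Icc M.θlo M.θhi) ∨ (M.Unimodal ∧ M.θhi ≤ M.thetaC M.θlo)) →
      ∃ q₀ ∈ M.Q, ∃ q, M.IsOptimal RatingModel.quality (RatingModel.passFail q₀) q) ∧
    -- lower censorship without exclusion is optimal if the density is decreasing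
    (AntitoneOn M.f (Set.Icc M.θlo M.θhi) →
      ∃ q₀ ∈ M.Q, ∃ q, M.IsOptimal RatingModel.quality (RatingModel.lowerCensorship q₀) q ∧
        M.cutoff q₀ ≤ M.θlo ∧ M.NoExclusion q) ∧
    -- the fully revealing test is optimal iff the density is decreasing and the lowest type is 0
    ((∃ q, M.IsOptimal RatingModel.quality RatingModel.fullyRevealing q) ↔
      AntitoneOn M.f (Set.Icc M.θlo M.θhi) ∧ M.θlo = 0) ∧
    -- for every mode there is an optimal cutoff type in `[θ_c⁻¹(θ_m), θ_m]`
    (M.Unimodal → ∀ m, M.IsMode m →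
      ∃ q₀ ∈ M.Q, (∃ q, M.IsOptimal RatingModel.quality (RatingModel.lowerCensorship q₀) q) ∧
        M.cutoff q₀ ∈ Set.Icc (M.thetaCInv m) m) ∧
    -- every optimal cutoff type is in `[θ_c⁻¹(θ_m), θ_m]` for some mode (thus for the mode, if unique)
    (M.Unimodal → ∀ q₀ ∈ M.Q,
      ((∃ q, M.IsOptimal RatingModel.quality (RatingModel.lowerCensorship q₀) q) ∨
        (∃ q, M.IsOptimal RatingModel.quality (RatingModel.passFail q₀) q)) →
      ∃ m, M.IsMode m ∧ M.cutoff q₀ ∈ Set.Icc (M.thetaCInv m) m) := by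
  refine ⟨fun hf => ?_, ?_, RatingModel.exists_isOptimal_lowerCensorship_noExclusion,
    RatingModel.exists_isOptimal_fullyRevealing_iff,
    fun hf m hm => hf.exists_isOptimal_lowerCensorship hm, fun hf x hx hopt => ?_⟩
  · obtain ⟨m, hm⟩ := M.exists_isMode
    obtain ⟨x, hx, hopt, -⟩ := hf.exists_isOptimal_lowerCensorship hm
    exact ⟨x, hx, hopt⟩
  · rintro (hmono | ⟨hf, hrange⟩)
    · obtain ⟨x, hx, hbest⟩ := RatingModel.exists_isBestMenu_passMenu_of_monotoneOn hmono
      exact ⟨x, hx, hbest.exists_isOptimal_passFail hx⟩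
    · obtain ⟨x, hx, hbest⟩ := hf.exists_isBestMenu_passMenu hrange
      exact ⟨x, hx, hbest.exists_isOptimal_passFail hx⟩
  · obtain ⟨m, hm, hcut, hmc⟩ :=
      hf.exists_isMode_of_isBestMenu hx (RatingModel.isBestMenu_lowerMenu_of_isOptimal hx hopt)
    exact ⟨m, hm, RatingModel.thetaCInv_le_cutoff hm.mem_Icc_zero hx hmc, hcut⟩
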